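/- Notation. Vectors are rows. $\mu_n$ is the standard Gaussian measure on $\mathbb R^n$, $\mu_\infty$ the product Gaussian measure on $\mathbb R^\infty$, $\mu_{n+\infty}=\mu_n\times\mu_\infty$; $\mathbb R^\times$ is the multiplicative group of positive reals with coordinate $t$, and $*$ is convolution on $\mathbb R^\times$. A polymorphism $(M,\mu)\rightsquigarrow(N,\nu)$ is a measure $\mathfrak P(m,n,t)$ on $M\times N\times\mathbb R^\times$ whose projection to $M$ is $\mu$ and such that the projection of $t\cdot\mathfrak P$ to $N$ is $\nu$. The product of polymorphisms (written left to right) is, for $\mathfrak P:M\rightsquigarrow N$ and $\mathfrak Q=\int \mathfrak Q_n\,d\nu(n):N\rightsquigarrow K$, the image of $d\mathfrak P(m,n,t)\,d\mathfrak Q_n(k,s)$ under $((m,n,t),(k,s))\mapsto(m,k,ts)$; $\mathfrak P^\star$ is the image of $t\cdot\mathfrak P$ under $(m,n,t)\mapsto(n,m,t^{-1})$. $\mathrm{GLO}(n+\infty)$ is the group of invertible operators $A=SU$ in $\ell_2$, given by real $(n+\infty)\times(n+\infty)$ matrices, with $U$ orthogonal, $S$ positive self-adjoint and $S-1$ Hilbert--Schmidt.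 $\mathrm O(\infty)\subset \mathrm{GLO}(n+\infty)$ is the subgroup of matrices $\begin{pmatrix}1&0\\0&u\end{pmatrix}$ with $u$ orthogonal, and $\mathrm{Coll}(n)=\mathrm O(\infty)\backslash\mathrm{GLO}(n+\infty)/\mathrm O(\infty)$. For $A\in\mathrm{GLO}(n+\infty)$ let $\mathfrak I(A)$ be the image of $\mu_{n+\infty}$ under $w\mapsto\bigl(w,\,wA,\,\tfrac{d\mu_{n+\infty}(wA)}{d\mu_{n+\infty}(w)}\bigr)$, let $\mathfrak l_n:(\mathbb R^n,\mu_n)\rightsquigarrow(\mathbb R^{n+\infty},\mu_{n+\infty})$ be the image of $\mu_{n+\infty}$ under $(x,y)\mapsto(x,(x,y),1)$, and for $\mathfrak a\in\mathrm{Coll}(n)$ let $\tau(\mathfrak a)=\mathfrak l_n\,\mathfrak I(A)\,\mathfrak l_n^\star:(\mathbb R^n,\mu_n)\rightsquigarrow(\mathbb R^n,\mu_n)$, where $A$ is any representative of $\mathfrak a$. For $M\ge0$ and $b\ne0$ let $\Phi[b,M]$ be the measure on $\mathbb R^\times$ equal to $$\frac1{\sqrt\pi}\,t^{1/b}(-b\ln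 t)^{-1/2}\cosh\sqrt{-\tfrac{4M}{b}\ln t}\;\frac{dt}t$$ on the set $\{b\ln t<0\}$ (i.e. $0<t<1$ if $b>0$ and $t>1$ if $b<0$) and $0$ outside it. Theorem. Let $\mathfrak a\in\mathrm{Coll}(n)$, $n<\infty$, have a representative of finite size $$G=\begin{pmatrix}a&b_1&b_2&0\\ c&d_1&d_2&0\\ 0&0&h&0\\ 0&0&0&1\end{pmatrix}$$ with blocks of sizes $n,\,n,\,m-n,\,\infty$ (rows and columns), where $c$ is invertible and $h$ is diagonal with entries $h_j\neq\pm1$ $(1\le j\le m-n)$. Put $b=(b_1\ b_2)$, $d=(d_1\ d_2)$, $H=(0\ h)$ and $$P=b-ac^{-1}d,\quad Q=-ac^{-1},\quad R=c^{-1}d,\quad T=c^{-1}.$$ For $x,u\in\mathbb R^n$ let $\psi_1,\dots,\psi_{m-n}$ be the last $m-n$ coordinates of the vector $xP+uR\in\mathbb R^{n+(m-n)}$, and let $N_{x,u}=A(x,u)\,\delta(t-B(x,u))$, where $$A(x,u)=|\det T|\exp\Bigl\{-\tfrac12\|xQ+uT\|^2-\tfrac12\bigl\|(xP+uR)H^t(1-HH^t)^{-1}\bigr\|^2\Bigr\},$$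 $$B(x,u)=|\det G|\exp\Bigl\{\tfrac12\bigl(\|xQ+uT\|^2+\|x\|^2-\|u\|^2-(xP+uR)(1-H^tH)^{-1}(xP+uR)^t\bigr)\Bigr\},$$ $\det G$ being the determinant of the finite part of $G$. Then $\tau(\mathfrak a)$, computed with any representative of $\mathfrak a$, is a polymorphism of $(\mathbb R^n,\mu_n)$ and equals the measure $$(2\pi)^{-n}e^{-\|x\|^2/2}\;\Bigl(N_{x,u}*\mathop{\circledast}_{j=1}^{m-n}\Phi\Bigl[h_j^2-1,\ \frac{h_j^2\psi_j^2}{2(1-h_j^2)^2}\Bigr]\Bigr)\,dx\,du$$ on $\mathbb R^n\times\mathbb R^n\times\mathbb R^\times$. -/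

import Mathlib

open MeasureTheory ProbabilityTheory Filter Topology
open scoped ENNReal Matrix

noncomputable section

namespace Polym

/-! ### The multiplicative group of positive reals -/

/-- The multiplicative group `ℝ^×` of positive real numbers, with coordinate `t`. -/
abbrev PosReal : Type := {t : ℝ // 0 < t}

instance : StandardBorelSpace PosReal :=
  MeasurableSet.standardBorel (s := {t : ℝ | 0 < t}) measurableSet_Ioi

/-- A positive real number as an element of `ℝ^×` (the value at `r ≤ 0` is irrelevant). -/
def toPos (r : ℝ) : PosReal := if h : 0 < r then ⟨r, h⟩ else 1

/-- Multiple convolution of finite measures on `ℝ^×`: the image of the product measure under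
multiplication `(t₁, …, t_k) ↦ t₁ ⋯ t_k`. -/
def multiConv {k : ℕ} (Φ : Fin k → Measure PosReal) : Measure PosReal :=
  (Measure.pi Φ).map (fun t => ∏ j, t j)

/-! ### Polymorphisms -/

section Polymorphisms

variable {M N K : Type*} [MeasurableSpace M] [MeasurableSpace N] [MeasurableSpace K]

/-- The measure `t · P(m, n, t)`. -/
def timesT (P : Measure (M × N × PosReal)) : Measure (M × N × PosReal) :=
  P.withDensity (fun z => ENNReal.ofReal (z.2.2 : ℝ))

/-- `P` is a polymorphism `(M, μ) ⇝ (N, ν)`: the projection of `P` to `M` is `μ` and the projection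
of `t · P` to `N` is `ν`. -/
structure IsPolymorphism (μ : Measure M) (ν : Measure N) (P : Measure (M × N × PosReal)) :
    Prop where
  map_left : P.map (fun z => z.1) = μ
  map_right : (timesT P).map (fun z => z.2.1) = ν

/-- The involution: `P⋆ : N ⇝ M` is the image of `t · P` under `(m, n, t) ↦ (n, m, t⁻¹)`, so that
`𝔍(g)⋆ = 𝔍(g⁻¹)`. -/
def star (P : Measure (M × N × PosReal)) : Measure (N × M × PosReal) :=
  (timesT P).map (fun z => (z.2.1, z.1, z.2.2⁻¹))

/-- The product of polymorphisms `P : M ⇝ N` and `Q : N ⇝ K` (first `P`, then `Q`).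
Disintegrate `Q = ∫ Q_n dν(n)` over its projection `ν` to `N`; the product is the image of
`dP(m, n, t) dQ_n(k, s)` under `((m, n, t), (k, s)) ↦ (m, k, ts)`. For absolutely continuous
polymorphisms `dP = dp(m,n)(t) dν(n) dμ(m)`, `dQ = dq(n,k)(s) dκ(k) dν(n)` one has
`dQ_n = dq(n,k)(s) dκ(k)`, and this is the polymorphism with fibre measures
`r(m, k) = ∫_N p(m, n) * q(n, k) dν(n)`. -/
def comp [StandardBorelSpace K] [Nonempty K]
    (P : Measure (M × N × PosReal)) (Q : Measure (N × K × PosReal)) [IsFiniteMeasure Q] :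
    Measure (M × K × PosReal) :=
  (P ⊗ₘ (Q.condKernel.comap (fun z : M × N × PosReal => z.2.1)
      (measurable_fst.comp measurable_snd))).map
    (fun w => (w.1.1, w.2.1, w.1.2.2 * w.2.2))

/-- The polymorphism `𝔍(g)` of an (almost surely defined) map `g` with Radon--Nikodym derivative
`g'`: the image of `μ` under `m ↦ (m, g(m), g'(m))`. -/
def ofMap (μ : Measure M) (g : M → M) (g' : M → PosReal) : Measure (M × M × PosReal) :=
  μ.map (fun m => (m, g m, g' m))

end Polymorphisms

/-! ### Gaussian measures -/

/-- `ℝⁿ`, row vectors. -/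
abbrev RN (n : ℕ) : Type := Fin n → ℝ

/-- `ℝ^{n+∞} = ℝⁿ × ℝ^∞`. -/
abbrev RNInf (n : ℕ) : Type := (Fin n → ℝ) × (ℕ → ℝ)

/-- The standard Gaussian measure `μ_n` on `ℝⁿ`. -/
def gaussN (n : ℕ) : Measure (RN n) := Measure.pi (fun _ => gaussianReal 0 1)

/-- The Gaussian measure `μ_{n+∞} = μ_n × μ_∞` on `ℝⁿ × ℝ^∞`. -/
def gaussNInf (n : ℕ) : Measure (RNInf n) :=
  (gaussN n).prod (Measure.infinitePi (fun _ : ℕ => gaussianReal 0 1))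

instance (n : ℕ) : IsProbabilityMeasure (gaussN n) := by
  unfold gaussN; infer_instance

instance (n : ℕ) : IsProbabilityMeasure (gaussNInf n) := by
  unfold gaussNInf; infer_instance

/-! ### The group `GLO(n + ∞)` and operator colligations -/

/-- The Hilbert space `ℓ₂` with orthonormal basis indexed by `n + ∞`. -/
abbrev Hil (n : ℕ) : Type := lp (fun _ : Fin n ⊕ ℕ => ℝ) 2

/-- The standard basis of `ℓ₂`. -/
def basisVec (n : ℕ) (i : Fin n ⊕ ℕ) : Hil n := lp.single 2 i (1 : ℝ)

/-- The matrix of a bounded operator in `ℓ₂` acting on columns; products of operators correspond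
to products of matrices. -/
def toMat {n : ℕ} (A : Hil n →L[ℝ] Hil n) : Matrix (Fin n ⊕ ℕ) (Fin n ⊕ ℕ) ℝ :=
  fun i j => A (basisVec n j) i

/-- Hilbert--Schmidt operators: `∑_{ij} |t_{ij}|² < ∞`. -/
def IsHilbertSchmidt {n : ℕ} (T : Hil n →L[ℝ] Hil n) : Prop :=
  Summable (fun p : (Fin n ⊕ ℕ) × (Fin n ⊕ ℕ) => |toMat T p.1 p.2| ^ 2)

/-- `GLO(n + ∞)`: the invertible operators `A = S U` with `U` orthogonal, `S` positive self-adjoint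
and `S - 1` Hilbert--Schmidt. -/
def GLO (n : ℕ) : Set (Hil n →L[ℝ] Hil n)ˣ :=
  {A | ∃ S U : Hil n →L[ℝ] Hil n, S.IsPositive ∧ IsHilbertSchmidt (S - 1) ∧
    U ∈ unitary (Hil n →L[ℝ] Hil n) ∧ (A : Hil n →L[ℝ] Hil n) = S * U}

/-- The subgroup `O(∞)` of block matrices `(1 0; 0 u)` with `u` orthogonal. An orthogonal operator
has this form exactly when it fixes the first `n` basis vectors. -/
def OInf (n : ℕ) : Subgroup (Hil n →L[ℝ] Hil n)ˣ where
  carrier := {U | (U : Hil n →L[ℝ] Hil n) ∈ unitary (Hil n →L[ℝ] Hil n) ∧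
    ∀ i : Fin n, (U : Hil n →L[ℝ] Hil n) (basisVec n (Sum.inl i)) = basisVec n (Sum.inl i)}
  one_mem' := ⟨one_mem (unitary (Hil n →L[ℝ] Hil n)), fun i => by simp⟩
  mul_mem' := by
    rintro U V ⟨hU, hU'⟩ ⟨hV, hV'⟩
    refine ⟨by simpa using mul_mem hU hV, fun i => ?_⟩
    simp [hV' i, hU' i]
  inv_mem' := by
    rintro U ⟨hU, hU'⟩
    have hinv : ((U⁻¹ : (Hil n →L[ℝ] Hil n)ˣ) : Hil n →L[ℝ] Hil n)
        = Star.star (U : Hil n →L[ℝ] Hil n) :=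
      (left_inv_eq_right_inv (Unitary.mem_iff.1 hU).1 U.mul_inv).symm
    refine ⟨by rw [hinv]; exact Unitary.star_mem hU, fun i => ?_⟩
    have h1 : ((U⁻¹ : (Hil n →L[ℝ] Hil n)ˣ) : Hil n →L[ℝ] Hil n)
        ((U : Hil n →L[ℝ] Hil n) (basisVec n (Sum.inl i))) = basisVec n (Sum.inl i) := by
      rw [← mul_apply_eq_comp, U.inv_mul]; rfl
    rwa [hU' i] at h1

/-- The equivalence `g ∼ h₁ g h₂`, `h₁, h₂ ∈ O(∞)`, on `GLO(n + ∞)`. -/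
def collSetoid (n : ℕ) : Setoid (GLO n) :=
  (DoubleCoset.setoid (OInf n : Set (Hil n →L[ℝ] Hil n)ˣ)
    (OInf n : Set (Hil n →L[ℝ] Hil n)ˣ)).comap Subtype.val

/-- Operator colligations, `Coll(n) = O(∞) \ GLO(n + ∞) / O(∞)`. -/
def Coll (n : ℕ) : Type := Quotient (collSetoid n)

/-- The colligation represented by a matrix in `GLO(n + ∞)`. -/
def Coll.mk {n : ℕ} (A : GLO n) : Coll n := Quotient.mk (collSetoid n) A

/-! ### The action of `GLO(n + ∞)` on `ℝ^{n+∞}` and of colligations on `ℝⁿ` -/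

/-- The `j`-th coordinate `∑_i x_i a_{ij}` of `xA`; the series converges almost surely. -/
def rowCoord {n : ℕ} (A : Hil n →L[ℝ] Hil n) (x : RNInf n) (j : Fin n ⊕ ℕ) : ℝ :=
  ∑ i, x.1 i * toMat A (Sum.inl i) j
    + limUnder atTop (fun L : ℕ => ∑ l ∈ Finset.range L, x.2 l * toMat A (Sum.inr l) j)

/-- The map `x ↦ xA` of `ℝ^{n+∞}`. -/
def rowAct {n : ℕ} (A : Hil n →L[ℝ] Hil n) (x : RNInf n) : RNInf n :=
  (fun i => rowCoord A x (Sum.inl i), fun l => rowCoord A x (Sum.inr l))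

/-- The Radon--Nikodym derivative `dμ(xA)/dμ(x)` of the map `x ↦ xA`: the density with respect to
`μ = μ_{n+∞}` of the measure `E ↦ μ(EA)`, the image of `μ` under the inverse map `x ↦ xA⁻¹`. -/
def rnDer {n : ℕ} (A : (Hil n →L[ℝ] Hil n)ˣ) (x : RNInf n) : PosReal :=
  toPos ((((gaussNInf n).map
    (rowAct ((A⁻¹ : (Hil n →L[ℝ] Hil n)ˣ) : Hil n →L[ℝ] Hil n))).rnDeriv (gaussNInf n) x).toReal)

/-- The polymorphism `𝔍(A)` of `(ℝ^{n+∞}, μ_{n+∞})`. -/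
def polyOf {n : ℕ} (A : (Hil n →L[ℝ] Hil n)ˣ) : Measure (RNInf n × RNInf n × PosReal) :=
  ofMap (gaussNInf n) (rowAct (A : Hil n →L[ℝ] Hil n)) (rnDer A)

/-- The polymorphism `𝔩_n(x'; x, y; t) = Δ(x, x') × μ_∞(y) × δ(t - 1)` from `(ℝⁿ, μ_n)` to
`(ℝⁿ × ℝ^∞, μ_n × μ_∞)`. -/
def lPoly (n : ℕ) : Measure (RN n × RNInf n × PosReal) :=
  (gaussNInf n).map (fun w => (w.1, w, 1))

instance {n : ℕ} (A : (Hil n →L[ℝ] Hil n)ˣ) : IsFiniteMeasure (polyOf A) := by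
  unfold polyOf ofMap; infer_instance

instance (n : ℕ) : IsFiniteMeasure (star (lPoly n)) := by
  have : IsFiniteMeasure (timesT (lPoly n)) := by
    refine isFiniteMeasure_withDensity ?_
    have hm : Measurable (fun w : RNInf n => ((w.1, w, 1) : RN n × RNInf n × PosReal)) := by
      fun_prop
    rw [lPoly, lintegral_map (by fun_prop) hm]
    simp
  unfold star; infer_instance

/-- The polymorphism `𝔩_n 𝔍(A) 𝔩_n⋆ : (ℝⁿ, μ_n) ⇝ (ℝⁿ, μ_n)` attached to `A ∈ GLO(n + ∞)`. It is the
value `τ(𝔞)` for the colligation `𝔞` represented by `A`. -/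
def tau {n : ℕ} (A : GLO n) : Measure (RN n × RN n × PosReal) :=
  comp (comp (lPoly n) (polyOf (A : (Hil n →L[ℝ] Hil n)ˣ))) (star (lPoly n))

/-! ### The measures `Φ[b, M]` -/

/-- The measure `Φ[b, M]` on `ℝ^×`. For `b ≠ 0` it is
`π^{-1/2} t^{1/b} (-b ln t)^{-1/2} cosh √(-4M b⁻¹ ln t) dt/t` on the set where `b ln t < 0`
(that is, `0 < t < 1` for `b > 0` and `t > 1` for `b < 0`), and `Φ[0, M] = e^M δ(t - 1)`. -/
def Phi (b M : ℝ) : Measure PosReal :=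
  if b = 0 then ENNReal.ofReal (Real.exp M) • Measure.dirac 1
  else (Measure.comap Subtype.val (volume : Measure ℝ)).withDensity (fun t : PosReal =>
    if b * Real.log t < 0 then
      ENNReal.ofReal ((Real.sqrt Real.pi)⁻¹ * (t : ℝ) ^ (1 / b) *
        (Real.sqrt (-(b * Real.log t)))⁻¹ *
        Real.cosh (Real.sqrt (-(4 * M / b * Real.log t))) / t)
    else 0)

/-! ### The finite-size representative and the measures `N_{x,u}` -/

/-- The position in `n + ∞` of the indices of the block decomposition `(n + n + k) + ∞`. -/
def blockIdx (n k : ℕ) : (Fin n ⊕ (Fin n ⊕ Fin k)) ⊕ ℕ → Fin n ⊕ ℕ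
  | Sum.inl (Sum.inl i) => Sum.inl i
  | Sum.inl (Sum.inr (Sum.inl i)) => Sum.inr i
  | Sum.inl (Sum.inr (Sum.inr j)) => Sum.inr (n + j)
  | Sum.inr l => Sum.inr (n + k + l)

/-- The blocks `a, b₁, b₂, c, d₁, d₂` and the diagonal `h_1, …, h_k` of a finite-size matrix in
canonical form, of block size `n + n + k`. -/
structure FinData (n k : ℕ) where
  a : Matrix (Fin n) (Fin n) ℝ
  b₁ : Matrix (Fin n) (Fin n) ℝ
  b₂ : Matrix (Fin n) (Fin k) ℝ
  c : Matrix (Fin n) (Fin n) ℝ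
  d₁ : Matrix (Fin n) (Fin n) ℝ
  d₂ : Matrix (Fin n) (Fin k) ℝ
  h : Fin k → ℝ

namespace FinData

variable {n k : ℕ} (D : FinData n k)

/-- `b = (b₁ b₂)`. -/
def b : Matrix (Fin n) (Fin n ⊕ Fin k) ℝ := Matrix.fromCols D.b₁ D.b₂

/-- `d = (d₁ d₂)`. -/
def d : Matrix (Fin n) (Fin n ⊕ Fin k) ℝ := Matrix.fromCols D.d₁ D.d₂

/-- `H = (0 h)`, where `h` is the diagonal matrix with entries `h_j`. -/
def H : Matrix (Fin k) (Fin n ⊕ Fin k) ℝ := Matrix.fromCols 0 (Matrix.diagonal D.h)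

/-- The finite block of the matrix `G`, with rows `(a b₁ b₂)`, `(c d₁ d₂)`, `(0 0 h)`. -/
def finG : Matrix (Fin n ⊕ (Fin n ⊕ Fin k)) (Fin n ⊕ (Fin n ⊕ Fin k)) ℝ :=
  Matrix.fromBlocks D.a D.b (Matrix.fromRows D.c 0) (Matrix.fromRows D.d D.H)

/-- The operator `G` in `ℓ₂` has the matrix `(finG 0; 0 1)`. -/
def IsRep (G : Hil n →L[ℝ] Hil n) : Prop :=
  ∀ i j, toMat G (blockIdx n k i) (blockIdx n k j) = Matrix.fromBlocks D.finG 0 0 1 i j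

/-- Potapov coordinate `P = b - a c⁻¹ d`. -/
def P : Matrix (Fin n) (Fin n ⊕ Fin k) ℝ := D.b - D.a * D.c⁻¹ * D.d

/-- Potapov coordinate `Q = -a c⁻¹`. -/
def Q : Matrix (Fin n) (Fin n) ℝ := -(D.a * D.c⁻¹)

/-- Potapov coordinate `R = c⁻¹ d`. -/
def R : Matrix (Fin n) (Fin n ⊕ Fin k) ℝ := D.c⁻¹ * D.d

/-- Potapov coordinate `T = c⁻¹`. -/
def T : Matrix (Fin n) (Fin n) ℝ := D.c⁻¹

/-- The row vector `xP + uR`. -/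
def v (x u : RN n) : Fin n ⊕ Fin k → ℝ := x ᵥ* D.P + u ᵥ* D.R

/-- The row vector `xQ + uT`. -/
def y (x u : RN n) : RN n := x ᵥ* D.Q + u ᵥ* D.T

/-- `ψ_1, …, ψ_k`, the coordinates of `xP₂ + uR₂`, the second part of `xP + uR`. -/
def psi (x u : RN n) (j : Fin k) : ℝ := D.v x u (Sum.inr j)

/-- The Euclidean norm squared of a row vector. -/
def normSq {ι : Type*} [Fintype ι] (w : ι → ℝ) : ℝ := w ⬝ᵥ w

/-- `A(x, u) = |det T| exp(-½‖xQ + uT‖² - ½‖(xP + uR) Hᵗ (1 - H Hᵗ)⁻¹‖²)`. -/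
def weight (x u : RN n) : ℝ :=
  |D.T.det| * Real.exp (-(1 / 2) * normSq (D.y x u)
    - 1 / 2 * normSq (D.v x u ᵥ* (D.Hᵀ * (1 - D.H * D.Hᵀ)⁻¹)))

/-- `B(x, u) = |det G| exp(½(‖xQ + uT‖² + ‖x‖² - ‖u‖² - (xP + uR)(1 - HᵗH)⁻¹(xP + uR)ᵗ))`. -/
def point (x u : RN n) : ℝ :=
  |D.finG.det| * Real.exp (1 / 2 * (normSq (D.y x u) + normSq x - normSq u
    - (D.v x u ᵥ* (1 - D.Hᵀ * D.H)⁻¹) ⬝ᵥ D.v x u))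

/-- The weighted `δ`-measure `N_{x,u}(t) = A(x, u) δ(t - B(x, u))` on `ℝ^×`. -/
def N (x u : RN n) : Measure PosReal :=
  ENNReal.ofReal (D.weight x u) • Measure.dirac (toPos (D.point x u))

/-- The convolution `N_{x,u} * Φ[h_1² - 1, M_1] * ⋯ * Φ[h_k² - 1, M_k]` with
`M_j = h_j² ψ_j² / (2 (1 - h_j²)²)`. -/
def fibre (x u : RN n) : Measure PosReal :=
  Measure.mconv (D.N x u) (multiConv (fun j =>
    Phi (D.h j ^ 2 - 1) (D.h j ^ 2 * D.psi x u j ^ 2 / (2 * (1 - D.h j ^ 2) ^ 2))))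

end FinData

end Polym

end

/-!
The measure `τ(𝔞)` is a law. Composing with `𝔩_n` and `𝔩_n⋆` only forgets coordinates, so `τ(𝔞)` is
the joint law, under `μ_{n+∞}`, of the first block of `w`, of the first block of `wA`, and of the
Radon–Nikodym derivative `dμ(wA)/dμ(w)` (`tau_eq_map`).

*Independence of the representative.* Write `A = UGV` with `U, V ∈ O(∞)` and `G` of finite size.
Orthogonal operators preserve `μ_{n+∞}` (`measurePreserving_rowAct`), and the action is
multiplicative up to null sets (`rowAct_mul_ae`). Hence the Radon–Nikodym derivative of `A` at `w`
is that of `G` at `wU`, and since `U` and `V` do not move the first block, the orthogonal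
substitution `w ↦ wU` turns the law for `A` into the law for `G` (`tau_eq_of_doubleCoset`). What
needs care is that `wA` is given by series which converge only almost surely: convergence comes from
the `L²`-bounded martingale theorem (`ae_exists_tendsto_sum_gaussian`), and the composition rule
from an `L²` limit along truncations (`pairing_rowAct_ae`).

*The finite computation.* For `G` only finitely many coordinates `z = (x, y, s)` matter, and the
derivative is `|det G| exp(½‖z‖² - ½‖zG‖²)`. The substitution `u = xa + yc` makes `y` equal to
`xQ + uT` and produces the density in `(x, u)`. On the fibre over `(x, u)` the derivative is
`B(x, u) ∏ⱼ exp(½(1 - hⱼ²)(sⱼ - mⱼ)²)` with `mⱼ = hⱼψⱼ / (1 - hⱼ²)` (`FinData.linDer_finG`), and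
the law of one factor for a standard Gaussian `sⱼ` is `exp(-½mⱼ²) Φ[hⱼ² - 1, ½mⱼ²]`
(`map_gaussianReal_exp_eq_Phi`). Since the `sⱼ` are independent, the law of the product is the
convolution, and the constants `exp(-½mⱼ²)` make up the second exponent of the weight `A(x, u)`.
-/

noncomputable section
namespace Polym

/-! ### Families of Gaussian variables -/

/-- Cramér–Wold criterion: if every finite linear combination `∑ cᵢ Xᵢ` has the law
`N(0, ∑ cᵢ²)`, then the family `X` is distributed as a sequence of independent standard Gaussian
variables. -/
theorem map_eq_infinitePi_gaussianReal {Ω ι : Type*} [MeasurableSpace Ω] (P : Measure Ω)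
    [IsProbabilityMeasure P] (X : ι → Ω → ℝ) (hX : ∀ i, Measurable (X i))
    (h : ∀ (s : Finset ι) (c : ι → ℝ), P.map (fun ω => ∑ i ∈ s, c i * X i ω)
      = gaussianReal 0 (∑ i ∈ s, c i ^ 2).toNNReal) :
    P.map (fun ω i => X i ω) = Measure.infinitePi (fun _ : ι => gaussianReal 0 1) := by
  have h1 : ∀ i, P.map (X i) = gaussianReal 0 1 := fun i => by
    simpa using h {i} (fun _ => 1)
  have hind : iIndepFun X P := by
    rw [iIndepFun_iff_finset]
    intro s
    change iIndepFun (fun (i : s) ω => X i ω) P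
    rw [iIndepFun_iff_charFun_pi (fun i : s => (hX i).aemeasurable)]
    intro t
    classical
    let c : ι → ℝ := fun i => if hi : i ∈ s then t ⟨i, hi⟩ else 0
    have hc : ∀ i : s, c i = t i := fun i => by simp [c]
    have e1 : charFun (P.map (fun ω => WithLp.toLp 2 fun i : s => X i ω)) t
        = charFun (P.map (fun ω => ∑ i ∈ s, c i * X i ω)) 1 := by
      rw [charFun_apply, charFun_apply, integral_map (by fun_prop) (by fun_prop),
        integral_map (by fun_prop) (by fun_prop)]
      congr 1 with ω
      congr 2
      rw [← Finset.sum_coe_sort s]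
      simp [PiLp.inner_apply, hc]
    rw [e1, h, charFun_gaussianReal]
    have e2 : ∀ i : s, charFun (P.map (X i)) (t i)
        = Complex.exp (-(t i : ℂ) ^ 2 / 2) := fun i => by
      rw [h1, charFun_gaussianReal]
      simp [neg_div]
    rw [Finset.prod_congr rfl (fun i _ => e2 i), ← Complex.exp_sum,
      Real.coe_toNNReal _ (Finset.sum_nonneg fun i _ => sq_nonneg _), ← Finset.sum_coe_sort s]
    simp [hc, neg_div, Finset.sum_div]
  rw [(iIndepFun_iff_map_fun_eq_infinitePi_map hX).1 hind]
  simp_rw [h1]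

/-- A linear combination of independent standard Gaussian variables is Gaussian. -/
theorem map_sum_mul_gaussianReal {Ω ι : Type*} [MeasurableSpace Ω] {P : Measure Ω}
    [IsProbabilityMeasure P] {X : ι → Ω → ℝ} (hX : ∀ i, Measurable (X i))
    (hind : iIndepFun X P) (hlaw : ∀ i, P.map (X i) = gaussianReal 0 1)
    (s : Finset ι) (c : ι → ℝ) :
    P.map (fun ω => ∑ i ∈ s, c i * X i ω) = gaussianReal 0 (∑ i ∈ s, c i ^ 2).toNNReal := by
  classical
  induction s using Finset.induction_on with
  | empty => simp
  | insert a s ha ih =>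
    have hm : ∀ i, Measurable (fun ω => c i * X i ω) := fun i => by fun_prop
    have hi : iIndepFun (fun i ω => c i * X i ω) P :=
      hind.comp (fun i x => c i * x) (fun i => by fun_prop)
    have h2 := hi.indepFun_finsetSum_of_notMem hm ha
    have h3 : P.map (fun ω => c a * X a ω) = gaussianReal 0 (c a ^ 2).toNNReal := by
      have := Measure.map_map (μ := P) (g := fun x : ℝ => c a * x) (by fun_prop) (hX a)
      rw [hlaw, gaussianReal_map_const_mul] at this
      rw [show (fun ω => c a * X a ω) = (fun x : ℝ => c a * x) ∘ X a from rfl, ← this]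
      congr 1
      · simp
      · ext; simp [Real.coe_toNNReal _ (sq_nonneg (c a))]
    have e : (∑ j ∈ s, fun ω => c j * X j ω) = fun ω => ∑ j ∈ s, c j * X j ω := by
      ext; simp
    rw [e] at h2
    have h4 := gaussianReal_add_gaussianReal_of_indepFun h2.symm h3 ih
    rw [Finset.sum_insert ha, Real.toNNReal_add (sq_nonneg _)
      (Finset.sum_nonneg fun i _ => sq_nonneg _)]
    simp only [Finset.sum_insert ha]
    simpa [Pi.add_def] using h4

theorem integral_sq_gaussianReal (σ : NNReal) : ∫ x, x ^ 2 ∂(gaussianReal 0 σ) = σ := by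
  have := variance_id_gaussianReal (μ := 0) (v := σ)
  rw [variance_of_integral_eq_zero (by fun_prop) (by simp)] at this
  simpa using this

theorem integrable_sq_gaussianReal (σ : NNReal) :
    Integrable (fun x : ℝ => x ^ 2) (gaussianReal 0 σ) :=
  (memLp_id_gaussianReal (μ := 0) (v := σ) 2).integrable_sq

/-- A series `∑ vₗ xₗ` with square summable coefficients in independent standard Gaussian
variables converges almost surely, being an `L²`-bounded martingale. -/
theorem ae_exists_tendsto_sum_gaussian {Ω : Type*} [MeasurableSpace Ω] {P : Measure Ω}
    [IsProbabilityMeasure P] {X : ℕ → Ω → ℝ} (hX : ∀ i, Measurable (X i))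
    (hind : iIndepFun X P) (hlaw : ∀ i, P.map (X i) = gaussianReal 0 1)
    {v : ℕ → ℝ} (hv : Summable fun l => v l ^ 2) :
    ∀ᵐ ω ∂P, ∃ c, Tendsto (fun L => ∑ l ∈ Finset.range L, X l ω * v l) atTop (𝓝 c) := by
  have hint : ∀ i, Integrable (X i) P := fun i => by
    have : Integrable id (P.map (X i)) := by
      rw [hlaw]; exact (memLp_id_gaussianReal 1).integrable le_rfl
    simpa using (integrable_map_measure (by fun_prop) (by fun_prop)).1 this
  have hmean : ∀ i, ∫ ω, X i ω ∂P = 0 := fun i => by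
    have := integral_map (μ := P) (hX i).aemeasurable (f := fun x : ℝ => x) (by fun_prop)
    rw [← this, hlaw]; simp
  have hsm : ∀ i, StronglyMeasurable (X i) := fun i => (hX i).stronglyMeasurable
  set ℱ := Filtration.natural X hsm with hℱ
  -- the natural filtration at time `L` contains `X L`, so the `L`-th sum runs up to `L` inclusive
  set f : ℕ → Ω → ℝ := fun L ω => ∑ l ∈ Finset.range (L + 1), X l ω * v l with hf
  have hadX : ∀ i, StronglyMeasurable[ℱ i] (X i) := Filtration.stronglyAdapted_natural hsm
  have hmart : Martingale f ℱ P := by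
    refine martingale_of_condExp_sub_eq_zero_nat ?_ ?_ ?_
    · intro L
      refine Finset.stronglyMeasurable_fun_sum _ fun l hl => ?_
      exact ((hadX l).mono (ℱ.mono (by simpa [Nat.lt_succ_iff] using hl))).mul_const _
    · intro L
      exact integrable_finsetSum _ fun l _ => (hint l).mul_const _
    · intro L
      have e : f (L + 1) - f L = v (L + 1) • X (L + 1) := by
        ext ω; simp [hf, Finset.sum_range_succ _ (L + 1), mul_comm]
      rw [e]
      refine (condExp_smul _ _ _).trans ?_
      filter_upwards [hind.condExp_natural_ae_eq_of_lt hsm (Nat.lt_succ_self L)] with ω hω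
      simp only [Pi.smul_apply, Pi.zero_apply]
      rw [hω, hmean]; simp
  have hbdd : ∀ L, eLpNorm (f L) 1 P ≤ (1 + ∑' l, v l ^ 2).toNNReal := by
    intro L
    have hs : f L = fun ω => ∑ l ∈ Finset.range (L + 1), v l * X l ω := by
      ext; simp [hf, mul_comm]
    have hl := map_sum_mul_gaussianReal hX hind hlaw (Finset.range (L + 1)) v
    rw [← hs] at hl
    have hfm : Measurable (f L) := by
      rw [hs]; fun_prop
    have h1 : eLpNorm (f L) 1 P = ∫⁻ x, ‖x‖ₑ ∂(gaussianReal 0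
        (∑ l ∈ Finset.range (L + 1), v l ^ 2).toNNReal) := by
      rw [eLpNorm_one_eq_lintegral_enorm, ← hl, lintegral_map (by fun_prop) hfm]
    set σ := (∑ l ∈ Finset.range (L + 1), v l ^ 2).toNNReal with hσ
    have hsq := integral_sq_gaussianReal σ
    have hisq := integrable_sq_gaussianReal σ
    have h2 : ∫⁻ x, ‖x‖ₑ ∂(gaussianReal 0 σ) ≤ ∫⁻ x, ENNReal.ofReal (1 + x ^ 2)
        ∂(gaussianReal 0 σ) := by
      refine lintegral_mono fun x => ?_
      rw [Real.enorm_eq_ofReal_abs]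
      refine ENNReal.ofReal_le_ofReal ?_
      nlinarith [sq_nonneg (|x| - 1), sq_abs x, abs_nonneg x]
    have h3 : ∫⁻ x, ENNReal.ofReal (1 + x ^ 2) ∂(gaussianReal 0 σ) = ENNReal.ofReal (1 + σ) := by
      rw [← ofReal_integral_eq_lintegral_ofReal (f := fun x : ℝ => 1 + x ^ 2)
        ((integrable_const _).add hisq) (Eventually.of_forall fun x => by positivity),
        integral_add (integrable_const _) hisq, hsq]
      simp
    rw [h1]
    refine (h2.trans h3.le).trans ?_
    refine ENNReal.ofReal_le_ofReal ?_
    rw [hσ, Real.coe_toNNReal _ (Finset.sum_nonneg fun i _ => sq_nonneg _)]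
    gcongr
    exact hv.sum_le_tsum _ fun i _ => sq_nonneg _
  filter_upwards [hmart.submartingale.exists_ae_tendsto_of_bdd hbdd] with ω ⟨c, hc⟩
  exact ⟨c, (tendsto_add_atTop_iff_nat 1).1 hc⟩

/-! ### Coordinates on `ℝ^{n+∞}` -/

theorem measurable_sumElim {ι κ : Type*} :
    Measurable (fun p : (ι → ℝ) × (κ → ℝ) => (Sum.elim p.1 p.2 : ι ⊕ κ → ℝ)) := by
  refine measurable_pi_iff.2 fun i => ?_
  cases i with
  | inl i => exact (measurable_pi_apply i).comp measurable_fst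
  | inr i => exact (measurable_pi_apply i).comp measurable_snd

theorem map_sumElim_prod_infinitePi {ι κ : Type*} (ν : Measure ℝ) [IsProbabilityMeasure ν] :
    ((Measure.infinitePi (fun _ : ι => ν)).prod (Measure.infinitePi (fun _ : κ => ν))).map
      (fun p => (Sum.elim p.1 p.2 : ι ⊕ κ → ℝ)) = Measure.infinitePi (fun _ : ι ⊕ κ => ν) := by
  refine Measure.eq_infinitePi _ fun s t ht => ?_
  have e : (fun p : (ι → ℝ) × (κ → ℝ) => (Sum.elim p.1 p.2 : ι ⊕ κ → ℝ)) ⁻¹' Set.pi s t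
      = (Set.pi s.toLeft fun i => t (Sum.inl i)) ×ˢ (Set.pi s.toRight fun i => t (Sum.inr i)) := by
    ext p
    simp [Set.mem_pi]
  rw [Measure.map_apply measurable_sumElim
    (MeasurableSet.pi s.countable_toSet fun i _ => ht i), e, Measure.prod_prod,
    Measure.infinitePi_pi _ fun i _ => ht _, Measure.infinitePi_pi _ fun i _ => ht _]
  conv_rhs => rw [← Finset.toLeft_disjSum_toRight (u := s), Finset.prod_disjSum]

variable {n : ℕ}

/-- The coordinates of a point of `ℝ^{n+∞}` as one family indexed by `n + ∞`. -/
def coords (w : RNInf n) : Fin n ⊕ ℕ → ℝ := Sum.elim w.1 w.2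

theorem measurable_coords : Measurable (coords (n := n)) := measurable_sumElim

theorem measurable_coords_apply (i : Fin n ⊕ ℕ) : Measurable fun w : RNInf n => coords w i :=
  measurable_pi_iff.1 measurable_coords i

theorem map_coords_gaussNInf :
    (gaussNInf n).map coords = Measure.infinitePi (fun _ => gaussianReal 0 1) := by
  rw [← map_sumElim_prod_infinitePi, gaussNInf, gaussN, ← Measure.infinitePi_eq_pi]
  rfl

/-- A measure on `ℝ^{n+∞}` is determined by the joint law of the coordinates. -/
theorem measure_ext_coords {μ ν : Measure (RNInf n)} (h : μ.map coords = ν.map coords) :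
    μ = ν := by
  have hm : Measurable fun f : Fin n ⊕ ℕ → ℝ =>
      ((fun i => f (Sum.inl i), fun l => f (Sum.inr l)) : RNInf n) := by fun_prop
  have e : ∀ ρ : Measure (RNInf n), (ρ.map coords).map (fun f : Fin n ⊕ ℕ → ℝ =>
      ((fun i => f (Sum.inl i), fun l => f (Sum.inr l)) : RNInf n)) = ρ := fun ρ => by
    rw [Measure.map_map hm measurable_coords]
    exact Measure.map_id
  rw [← e μ, h, e]

theorem map_coords_apply_gaussNInf (i : Fin n ⊕ ℕ) :
    (gaussNInf n).map (fun w => coords w i) = gaussianReal 0 1 := by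
  have := Measure.map_map (μ := gaussNInf n) (measurable_pi_apply i) (measurable_coords (n := n))
  rw [map_coords_gaussNInf, Measure.infinitePi_map_eval] at this
  exact this.symm

theorem iIndepFun_coords : iIndepFun (fun i (w : RNInf n) => coords w i) (gaussNInf n) := by
  rw [iIndepFun_iff_map_fun_eq_infinitePi_map measurable_coords_apply]
  simp_rw [map_coords_apply_gaussNInf]
  exact map_coords_gaussNInf

/-! ### The Gaussian functional attached to a vector of `ℓ₂` -/

/-- The partial sums of the series `∑ᵢ wᵢ vᵢ` over `n + ∞`. -/
def partialPairing (v : Fin n ⊕ ℕ → ℝ) (w : RNInf n) (L : ℕ) : ℝ :=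
  ∑ i, w.1 i * v (Sum.inl i) + ∑ l ∈ Finset.range L, w.2 l * v (Sum.inr l)

/-- The series `∑ᵢ wᵢ vᵢ`, which converges for almost all `w` when `v ∈ ℓ₂`. The `j`-th coordinate
of `wA` is the value at the `j`-th column of `A`. -/
def pairing (v : Fin n ⊕ ℕ → ℝ) (w : RNInf n) : ℝ :=
  ∑ i, w.1 i * v (Sum.inl i)
    + limUnder atTop (fun L : ℕ => ∑ l ∈ Finset.range L, w.2 l * v (Sum.inr l))

/-- The initial segments of `n + ∞`. -/
def initSeg (n L : ℕ) : Finset (Fin n ⊕ ℕ) := Finset.univ.disjSum (Finset.range L)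

theorem tendsto_initSeg : Tendsto (initSeg n) atTop atTop := by
  refine tendsto_atTop_finset_of_monotone (fun a b h => ?_) fun x => ?_
  · exact Finset.disjSum_mono_right _ (Finset.range_mono h)
  · cases x with
    | inl i => exact ⟨0, by simp [initSeg]⟩
    | inr l => exact ⟨l + 1, by simp [initSeg]⟩

theorem partialPairing_eq_sum (v : Fin n ⊕ ℕ → ℝ) (w : RNInf n) (L : ℕ) :
    partialPairing v w L = ∑ i ∈ initSeg n L, v i * coords w i := by
  simp [partialPairing, initSeg, coords, Finset.sum_disjSum, mul_comm]

theorem pairing_eq_of_tendsto {v : Fin n ⊕ ℕ → ℝ} {w : RNInf n} {c : ℝ}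
    (h : Tendsto (partialPairing v w) atTop (𝓝 c)) : pairing v w = c := by
  have h2 : Tendsto (fun L : ℕ => ∑ l ∈ Finset.range L, w.2 l * v (Sum.inr l)) atTop
      (𝓝 (c - ∑ i, w.1 i * v (Sum.inl i))) := by
    have := h.sub_const (∑ i, w.1 i * v (Sum.inl i))
    simpa [partialPairing] using this
  rw [pairing, h2.limUnder_eq]; ring

theorem measurable_pairing (v : Fin n ⊕ ℕ → ℝ) : Measurable (pairing v) := by
  have h : StronglyMeasurable fun w : RNInf n =>
      limUnder atTop (fun L : ℕ => ∑ l ∈ Finset.range L, w.2 l * v (Sum.inr l)) := by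
    refine StronglyMeasurable.limUnder fun L => Measurable.stronglyMeasurable ?_
    fun_prop
  have := h.measurable
  unfold pairing
  fun_prop

theorem summable_sq (v : Hil n) : Summable fun i => v i ^ 2 := by
  simpa using (lp.hasSum_norm (by simp) v).summable

theorem hasSum_sq (v : Hil n) : HasSum (fun i => v i ^ 2) (‖v‖ ^ 2) := by
  simpa using lp.hasSum_norm (by simp) v

theorem ae_tendsto_partialPairing (v : Hil n) :
    ∀ᵐ w ∂(gaussNInf n), Tendsto (partialPairing v w) atTop (𝓝 (pairing v w)) := by
  have h := ae_exists_tendsto_sum_gaussian (P := gaussNInf n)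
    (X := fun l w => coords w (Sum.inr l)) (v := fun l => v (Sum.inr l))
    (fun l => measurable_coords_apply _)
    (iIndepFun_coords.precomp Sum.inr_injective) (fun l => map_coords_apply_gaussNInf _)
    ((summable_sq v).comp_injective Sum.inr_injective)
  filter_upwards [h] with w ⟨c, hc⟩
  have h2 : Tendsto (partialPairing v w) atTop (𝓝 (∑ i, w.1 i * v (Sum.inl i) + c)) :=
    hc.const_add _
  rwa [pairing_eq_of_tendsto h2]

theorem pairing_finsetSum_ae {ι : Type*} (s : Finset ι) (c : ι → ℝ) (v : ι → Hil n) :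
    ∀ᵐ w ∂(gaussNInf n),
      pairing (∑ i ∈ s, c i • v i : Hil n) w = ∑ i ∈ s, c i * pairing (v i) w := by
  have h : ∀ᵐ w ∂(gaussNInf n), ∀ i ∈ s,
      Tendsto (partialPairing (v i) w) atTop (𝓝 (pairing (v i) w)) :=
    (Finset.eventually_all s).2 fun i _ => ae_tendsto_partialPairing (v i)
  filter_upwards [h] with w hw
  refine pairing_eq_of_tendsto ?_
  have := tendsto_finsetSum s fun i hi => (hw i hi).const_mul (c i)
  refine this.congr fun L => ?_
  simp only [partialPairing_eq_sum, lp.coeFn_sum, lp.coeFn_smul, Finset.sum_apply, Pi.smul_apply,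
    smul_eq_mul, Finset.mul_sum, Finset.sum_mul]
  rw [Finset.sum_comm]
  exact Finset.sum_congr rfl fun i _ => Finset.sum_congr rfl fun j _ => by ring

theorem pairing_sub_ae (v v' : Hil n) :
    ∀ᵐ w ∂(gaussNInf n), pairing (v - v' : Hil n) w = pairing v w - pairing v' w := by
  filter_upwards [pairing_finsetSum_ae Finset.univ ![1, -1] ![v, v']] with w hw
  simpa [Fin.sum_univ_two, sub_eq_add_neg] using hw

/-- The Gaussian functionals are isonormal: the variance of the pairing with `v` is `‖v‖²`. -/
theorem map_pairing (v : Hil n) :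
    (gaussNInf n).map (pairing v) = gaussianReal 0 (‖v‖ ^ 2).toNNReal := by
  have hv := measurable_pairing (n := n) v
  have : IsProbabilityMeasure ((gaussNInf n).map (pairing v)) :=
    Measure.isProbabilityMeasure_map hv.aemeasurable
  have hp : ∀ L, Measurable fun w : RNInf n => partialPairing v w L := fun L => by
    unfold partialPairing; fun_prop
  refine Measure.ext_of_charFun (funext fun t => ?_)
  have h1 : Tendsto (fun L => charFun ((gaussNInf n).map fun w => partialPairing v w L) t) atTop
      (𝓝 (charFun ((gaussNInf n).map (pairing v)) t)) := by
    simp_rw [charFun_apply_real]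
    rw [integral_map hv.aemeasurable (by fun_prop)]
    simp_rw [integral_map (hp _).aemeasurable
      (f := fun x : ℝ => Complex.exp (t * x * Complex.I)) (by fun_prop)]
    refine tendsto_integral_of_dominated_convergence (fun _ => 1) (fun L => ?_)
      (integrable_const _) (fun L => ?_) ?_
    · have := hp L
      exact Measurable.aestronglyMeasurable (by fun_prop)
    · refine Eventually.of_forall fun w => ?_
      rw [← Complex.ofReal_mul, Complex.norm_exp_ofReal_mul_I]
    · filter_upwards [ae_tendsto_partialPairing v] with w hw
      have hc : Continuous fun x : ℝ => Complex.exp (t * x * Complex.I) := by fun_prop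
      exact (hc.tendsto _).comp hw
  have h2 : ∀ L, (gaussNInf n).map (fun w => partialPairing v w L)
      = gaussianReal 0 (∑ i ∈ initSeg n L, v i ^ 2).toNNReal := fun L => by
    simp_rw [partialPairing_eq_sum]
    exact map_sum_mul_gaussianReal measurable_coords_apply iIndepFun_coords
      map_coords_apply_gaussNInf _ _
  have h3 : Tendsto (fun L => ∑ i ∈ initSeg n L, v i ^ 2) atTop (𝓝 (‖v‖ ^ 2)) :=
    (hasSum_sq v).comp tendsto_initSeg
  simp_rw [h2, charFun_gaussianReal,
    fun L => Real.coe_toNNReal (∑ i ∈ initSeg n L, v i ^ 2)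
      (Finset.sum_nonneg fun i _ => sq_nonneg _)] at h1
  rw [charFun_gaussianReal, Real.coe_toNNReal _ (sq_nonneg _)]
  refine tendsto_nhds_unique h1 ?_
  have hc : Continuous fun x : ℝ =>
      Complex.exp (t * (0 : ℝ) * Complex.I - x * t ^ 2 / 2) := by fun_prop
  exact (hc.tendsto _).comp h3

/-! ### The action of operators on `ℝ^{n+∞}` -/

theorem coords_rowAct (A : Hil n →L[ℝ] Hil n) (w : RNInf n) (j : Fin n ⊕ ℕ) :
    coords (rowAct A w) j = pairing (A (basisVec n j)) w := by
  cases j <;> rfl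

theorem coords_injective : Function.Injective (coords (n := n)) := by
  intro w w' h
  refine Prod.ext (funext fun i => ?_) (funext fun l => ?_)
  · exact congrFun h (Sum.inl i)
  · exact congrFun h (Sum.inr l)

theorem measurable_rowAct (A : Hil n →L[ℝ] Hil n) : Measurable (rowAct A) := by
  refine Measurable.prodMk (measurable_pi_iff.2 fun i => ?_) (measurable_pi_iff.2 fun l => ?_)
  · exact measurable_pairing (A (basisVec n (Sum.inl i)))
  · exact measurable_pairing (A (basisVec n (Sum.inr l)))

theorem smul_basisVec (r : ℝ) (i : Fin n ⊕ ℕ) : r • basisVec n i = lp.single 2 i r := by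
  rw [basisVec, ← lp.single_smul]; simp

theorem norm_sum_smul_basisVec_sq (s : Finset (Fin n ⊕ ℕ)) (c : Fin n ⊕ ℕ → ℝ) :
    ‖∑ i ∈ s, c i • basisVec n i‖ ^ 2 = ∑ i ∈ s, c i ^ 2 := by
  have := lp.norm_sum_single (p := 2) (E := fun _ : Fin n ⊕ ℕ => ℝ) (by simp) c s
  simp_rw [smul_basisVec]
  simpa using this

/-- Orthogonal operators preserve the Gaussian measure. -/
theorem measurePreserving_rowAct {U : Hil n →L[ℝ] Hil n}
    (hU : U ∈ unitary (Hil n →L[ℝ] Hil n)) :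
    MeasurePreserving (rowAct U) (gaussNInf n) (gaussNInf n) := by
  refine ⟨measurable_rowAct U, measure_ext_coords ?_⟩
  rw [Measure.map_map measurable_coords (measurable_rowAct U), map_coords_gaussNInf]
  have e : coords ∘ rowAct U = fun w i => pairing (U (basisVec n i)) w :=
    funext fun w => funext fun i => coords_rowAct U w i
  rw [e]
  refine map_eq_infinitePi_gaussianReal _ _ (fun i => measurable_pairing _) fun s c => ?_
  rw [← norm_sum_smul_basisVec_sq, ← ContinuousLinearMap.norm_map_of_mem_unitary hU, ← map_pairing]
  refine Measure.map_congr ?_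
  filter_upwards [pairing_finsetSum_ae s c fun i => U (basisVec n i)] with w hw
  rw [← hw, map_sum]
  simp

theorem tendsto_sum_smul_basisVec (v : Hil n) :
    Tendsto (fun L => ∑ i ∈ initSeg n L, v i • basisVec n i) atTop (𝓝 v) := by
  have h := lp.hasSum_single (p := 2) (by simp) v
  simp_rw [smul_basisVec]
  exact h.comp tendsto_initSeg

/-- The formal computation `∑ⱼ (wA)ⱼ vⱼ = ∑ᵢ wᵢ (Av)ᵢ` is valid almost surely as soon as `w ↦ wA`
does not charge null sets: both sides are limits along the truncations of `v`, the left one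
almost surely and the right one in `L²`. -/
theorem pairing_rowAct_ae {A : Hil n →L[ℝ] Hil n}
    (hA : Measure.QuasiMeasurePreserving (rowAct A) (gaussNInf n) (gaussNInf n)) (v : Hil n) :
    ∀ᵐ w ∂(gaussNInf n), pairing v (rowAct A w) = pairing (A v) w := by
  set vL : ℕ → Hil n := fun L => ∑ i ∈ initSeg n L, v i • basisVec n i with hvL
  have h1 : ∀ᵐ w ∂(gaussNInf n),
      Tendsto (partialPairing v (rowAct A w)) atTop (𝓝 (pairing v (rowAct A w))) :=
    hA.ae (ae_tendsto_partialPairing v)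
  have h2 : ∀ᵐ w ∂(gaussNInf n), ∀ L,
      pairing (A (vL L) - A v) w = partialPairing v (rowAct A w) L - pairing (A v) w := by
    refine ae_all_iff.2 fun L => ?_
    filter_upwards [pairing_finsetSum_ae (initSeg n L) v fun i => A (basisVec n i),
      pairing_sub_ae (A (vL L)) (A v)] with w hw hw'
    rw [hw', partialPairing_eq_sum]
    simp_rw [coords_rowAct]
    rw [← hw, hvL, map_sum]
    simp
  have h3 : ∀ L, ∫⁻ w, ENNReal.ofReal (pairing (A (vL L) - A v) w ^ 2) ∂(gaussNInf n)
      = ENNReal.ofReal (‖A (vL L) - A v‖ ^ 2) := fun L => by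
    set σ := (‖A (vL L) - A v‖ ^ 2).toNNReal with hσ
    have := lintegral_map (μ := gaussNInf n) (f := fun x : ℝ => ENNReal.ofReal (x ^ 2))
      (by fun_prop) (measurable_pairing (A (vL L) - A v))
    rw [map_pairing] at this
    rw [← this, ← ofReal_integral_eq_lintegral_ofReal (integrable_sq_gaussianReal σ)
      (Eventually.of_forall fun x => by positivity), integral_sq_gaussianReal, hσ,
      Real.coe_toNNReal _ (sq_nonneg _)]
  have h4 : Tendsto (fun L => ENNReal.ofReal (‖A (vL L) - A v‖ ^ 2)) atTop (𝓝 0) := by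
    have ht : Tendsto (fun L => A (vL L) - A v) atTop (𝓝 0) := by
      have := ((A.continuous.tendsto v).comp (tendsto_sum_smul_basisVec v)).sub_const (A v)
      rwa [sub_self] at this
    have := ENNReal.tendsto_ofReal ((ht.norm).pow 2)
    simpa using this
  have hm1 := measurable_pairing (n := n) v
  have hm2 := measurable_pairing (n := n) (A v)
  have hm3 := measurable_rowAct A
  have h5 : ∫⁻ w, ENNReal.ofReal ((pairing v (rowAct A w) - pairing (A v) w) ^ 2) ∂(gaussNInf n)
      = 0 := by
    refine le_antisymm ?_ zero_le
    calc _ ≤ ∫⁻ w, liminf (fun L => ENNReal.ofReal (pairing (A (vL L) - A v) w ^ 2)) atTop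
          ∂(gaussNInf n) := by
          refine lintegral_mono_ae ?_
          filter_upwards [h1, h2] with w hw1 hw2
          have : Tendsto (fun L => ENNReal.ofReal (pairing (A (vL L) - A v) w ^ 2)) atTop
              (𝓝 (ENNReal.ofReal ((pairing v (rowAct A w) - pairing (A v) w) ^ 2))) := by
            simp_rw [hw2]
            exact ENNReal.tendsto_ofReal ((hw1.sub_const _).pow 2)
          rw [this.liminf_eq]
      _ ≤ liminf (fun L => ∫⁻ w, ENNReal.ofReal (pairing (A (vL L) - A v) w ^ 2)
          ∂(gaussNInf n)) atTop := by
          refine lintegral_liminf_le fun L => ?_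
          have := measurable_pairing (n := n) (A (vL L) - A v : Hil n)
          fun_prop
      _ = 0 := by
          simp_rw [h3]
          exact h4.liminf_eq
  rw [lintegral_eq_zero_iff (by fun_prop)] at h5
  filter_upwards [h5] with w hw
  have : (pairing v (rowAct A w) - pairing (A v) w) ^ 2 ≤ 0 := by simpa using hw
  have := pow_eq_zero_iff (two_ne_zero) |>.1 (le_antisymm this (sq_nonneg _))
  linarith

/-- The row action is multiplicative up to null sets. -/
theorem rowAct_mul_ae {A : Hil n →L[ℝ] Hil n}
    (hA : Measure.QuasiMeasurePreserving (rowAct A) (gaussNInf n) (gaussNInf n))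
    (B : Hil n →L[ℝ] Hil n) :
    ∀ᵐ w ∂(gaussNInf n), rowAct (A * B) w = rowAct B (rowAct A w) := by
  filter_upwards [ae_all_iff.2 fun j => pairing_rowAct_ae hA (B (basisVec n j))] with w hw
  refine coords_injective (funext fun j => ?_)
  rw [coords_rowAct, coords_rowAct, hw]
  rfl

theorem partialPairing_sum_smul_basisVec {ι : Type*} [Fintype ι] (f : ι → Fin n ⊕ ℕ) (c : ι → ℝ)
    (w : RNInf n) : ∀ᶠ L in atTop,
      partialPairing (∑ i, c i • basisVec n (f i) : Hil n) w L = ∑ i, c i * coords w (f i) := by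
  have h : ∀ᶠ L in atTop, ∀ i, f i ∈ initSeg n L :=
    eventually_all.2 fun i =>
      (tendsto_initSeg.eventually_ge_atTop {f i}).mono fun L hL => hL (Finset.mem_singleton_self _)
  filter_upwards [h] with L hL
  simp only [partialPairing_eq_sum, lp.coeFn_sum, lp.coeFn_smul, Finset.sum_apply, Pi.smul_apply,
    smul_eq_mul, Finset.sum_mul]
  rw [Finset.sum_comm]
  refine Finset.sum_congr rfl fun i _ => ?_
  rw [Finset.sum_eq_single_of_mem _ (hL i) fun j _ hj => ?_]
  · simp [basisVec]
  · simp [basisVec, hj]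

/-- On finitely supported vectors the pairing is an everywhere defined linear functional. -/
theorem pairing_sum_smul_basisVec {ι : Type*} [Fintype ι] (f : ι → Fin n ⊕ ℕ) (c : ι → ℝ)
    (w : RNInf n) :
    pairing (∑ i, c i • basisVec n (f i) : Hil n) w = ∑ i, c i * coords w (f i) :=
  pairing_eq_of_tendsto (tendsto_const_nhds.congr'
    ((partialPairing_sum_smul_basisVec f c w).mono fun _ h => h.symm))

theorem pairing_basisVec (j : Fin n ⊕ ℕ) (w : RNInf n) :
    pairing (basisVec n j) w = coords w j := by
  simpa using pairing_sum_smul_basisVec (fun _ : Unit => j) (fun _ => 1) w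

theorem rowAct_one (w : RNInf n) : rowAct (1 : Hil n →L[ℝ] Hil n) w = w :=
  coords_injective (funext fun j => by rw [coords_rowAct]; exact pairing_basisVec j w)

/-- Elements of `O(∞)` do not move the first `n` coordinates. -/
theorem rowAct_fst_of_mem_OInf {U : (Hil n →L[ℝ] Hil n)ˣ} (hU : U ∈ OInf n) (w : RNInf n) :
    (rowAct (U : Hil n →L[ℝ] Hil n) w).1 = w.1 := by
  funext i
  have h := coords_rowAct (U : Hil n →L[ℝ] Hil n) w (Sum.inl i)
  rw [hU.2 i, pairing_basisVec] at h
  exact h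

/-! ### The Gaussian density and linear substitutions -/

section Density

variable {ι : Type*} [Fintype ι]

/-- The density of the standard Gaussian measure on `ℝ^ι`. -/
def gaussDensity (z : ι → ℝ) : ℝ :=
  (Real.sqrt (2 * Real.pi) ^ Fintype.card ι)⁻¹ * Real.exp (-(z ⬝ᵥ z) / 2)

theorem gaussDensity_pos (z : ι → ℝ) : 0 < gaussDensity z := by
  unfold gaussDensity; positivity

theorem measurable_gaussDensity : Measurable (gaussDensity (ι := ι)) := by
  unfold gaussDensity dotProduct; fun_prop

theorem gaussDensity_eq_prod (z : ι → ℝ) :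
    gaussDensity z = ∏ i, gaussianPDFReal 0 1 (z i) := by
  simp only [gaussianPDFReal, gaussDensity, Finset.prod_mul_distrib, ← Real.exp_sum, dotProduct,
    Finset.prod_const, Finset.card_univ, inv_pow]
  congr 2
  · simp
  · rw [← Finset.sum_neg_distrib, Finset.sum_div]
    exact Finset.sum_congr rfl fun i _ => by simp [sq]

theorem pi_gaussianReal_eq_withDensity :
    Measure.pi (fun _ : ι => gaussianReal 0 1)
      = (volume : Measure (ι → ℝ)).withDensity fun z => ENNReal.ofReal (gaussDensity z) := by
  refine Measure.pi_eq fun s hs => ?_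
  have hint : ∀ i, Integrable (gaussianPDFReal 0 1) (volume.restrict (s i)) := fun i =>
    (integrable_gaussianPDFReal 0 1).restrict
  rw [withDensity_apply _ (MeasurableSet.univ_pi hs), volume_pi, Measure.restrict_pi_pi]
  simp_rw [gaussDensity_eq_prod]
  rw [← ofReal_integral_eq_lintegral_ofReal]
  · rw [integral_fintype_prod_eq_prod (f := fun _ x => gaussianPDFReal 0 1 x),
      ENNReal.ofReal_prod_of_nonneg
        fun i _ => integral_nonneg fun x => gaussianPDFReal_nonneg _ _ _]
    exact Finset.prod_congr rfl fun i _ =>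
      (gaussianReal_apply_eq_integral 0 one_ne_zero (s i)).symm
  · exact Integrable.fintype_prod hint
  · exact Eventually.of_forall fun z =>
      Finset.prod_nonneg fun i _ => gaussianPDFReal_nonneg _ _ _

theorem measurable_vecMul {κ : Type*} (M : Matrix ι κ ℝ) : Measurable fun z : ι → ℝ => z ᵥ* M := by
  unfold Matrix.vecMul dotProduct; fun_prop

variable [DecidableEq ι]

theorem lintegral_comp_vecMul {M : Matrix ι ι ℝ} (hM : M.det ≠ 0) {f : (ι → ℝ) → ℝ≥0∞}
    (hf : Measurable f) :
    ∫⁻ z, f z = ENNReal.ofReal |M.det| * ∫⁻ z : ι → ℝ, f (z ᵥ* M) := by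
  have h := Real.map_matrix_volume_pi_eq_smul_volume_pi (M := Mᵀ) (by simpa using hM)
  have h2 := lintegral_map (μ := volume) hf (LinearMap.continuous_of_finiteDimensional
    (Matrix.toLin' Mᵀ)).measurable
  rw [h, lintegral_smul_measure] at h2
  simp only [Matrix.toLin'_apply, Matrix.mulVec_transpose, Matrix.det_transpose] at h2
  rw [← h2, smul_eq_mul, ← mul_assoc, ← ENNReal.ofReal_mul (abs_nonneg _), ← abs_mul,
    mul_inv_cancel₀ hM]
  simp

/-- The Radon–Nikodym derivative `dμ(zM)/dμ(z)` of the linear map `z ↦ zM` with respect to the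
standard Gaussian measure `μ` on `ℝ^ι`. -/
def linDer (M : Matrix ι ι ℝ) (z : ι → ℝ) : ℝ :=
  |M.det| * Real.exp (1 / 2 * (z ⬝ᵥ z - (z ᵥ* M) ⬝ᵥ (z ᵥ* M)))

theorem linDer_pos {M : Matrix ι ι ℝ} (hM : M.det ≠ 0) (z : ι → ℝ) : 0 < linDer M z := by
  unfold linDer; positivity

theorem measurable_linDer (M : Matrix ι ι ℝ) : Measurable (linDer M) := by
  have := measurable_vecMul M
  unfold linDer dotProduct; fun_prop

theorem map_vecMul_inv_pi_gaussianReal {M : Matrix ι ι ℝ} (hM : M.det ≠ 0) :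
    (Measure.pi (fun _ : ι => gaussianReal 0 1)).map (fun z => z ᵥ* M⁻¹)
      = (Measure.pi (fun _ : ι => gaussianReal 0 1)).withDensity
          fun z => ENNReal.ofReal (linDer M z) := by
  have hd := (measurable_gaussDensity (ι := ι)).ennreal_ofReal
  have hl := (measurable_linDer M).ennreal_ofReal
  have hv := measurable_vecMul M
  have hv' := measurable_vecMul M⁻¹
  refine Measure.ext_of_lintegral _ fun f hf => ?_
  have hfv : Measurable fun z => f (z ᵥ* M⁻¹) := hf.comp hv'
  rw [lintegral_map hf hv', lintegral_withDensity_eq_lintegral_mul _ hl hf,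
    pi_gaussianReal_eq_withDensity, lintegral_withDensity_eq_lintegral_mul _ hd (hfv),
    lintegral_withDensity_eq_lintegral_mul _ hd (hl.mul hf),
    lintegral_comp_vecMul hM (hd.mul hfv), ← lintegral_const_mul' _ _ ENNReal.ofReal_ne_top]
  refine lintegral_congr fun z => ?_
  simp only [Pi.mul_apply, Matrix.vecMul_vecMul,
    Matrix.mul_nonsing_inv _ (isUnit_iff_ne_zero.2 hM), Matrix.vecMul_one]
  rw [← mul_assoc, ← mul_assoc, ← ENNReal.ofReal_mul (abs_nonneg _),
    ← ENNReal.ofReal_mul (gaussDensity_pos z).le]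
  congr 2
  unfold gaussDensity linDer
  rw [show -(z ⬝ᵥ z) / 2 = -((z ᵥ* M) ⬝ᵥ (z ᵥ* M)) / 2
    - 1 / 2 * (z ⬝ᵥ z - (z ᵥ* M) ⬝ᵥ (z ᵥ* M)) by ring, Real.exp_sub]
  field_simp

end Density

/-! ### Operators of finite size -/

variable {k : ℕ}

/-- The finite part of the index set in the block decomposition. -/
abbrev FinIdx (n k : ℕ) : Type := Fin n ⊕ (Fin n ⊕ Fin k)

theorem blockIdx_bijective : Function.Bijective (blockIdx n k) := by
  constructor
  · rintro ((i | i | i) | i) ((j | j | j) | j) h <;>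
      simp only [blockIdx, Sum.inl.injEq, Sum.inr.injEq, reduceCtorEq] at h <;>
      first
      | rw [h]
      | (exfalso; omega)
      | (congr; omega)
  · rintro (i | l)
    · exact ⟨Sum.inl (Sum.inl i), rfl⟩
    · by_cases h1 : l < n
      · exact ⟨Sum.inl (Sum.inr (Sum.inl ⟨l, h1⟩)), rfl⟩
      · by_cases h2 : l < n + k
        · refine ⟨Sum.inl (Sum.inr (Sum.inr ⟨l - n, by omega⟩)), ?_⟩
          simp only [blockIdx, Sum.inr.injEq]; omega
        · refine ⟨Sum.inr (l - (n + k)), ?_⟩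
          simp only [blockIdx, Sum.inr.injEq]; omega

/-- The operator `A` of `ℓ₂` has the matrix `(M 0; 0 1)` with respect to the block decomposition,
expressed through its columns. -/
structure IsFiniteBlock (M : Matrix (FinIdx n k) (FinIdx n k) ℝ) (A : Hil n →L[ℝ] Hil n) :
    Prop where
  apply_inl : ∀ j, A (basisVec n (blockIdx n k (Sum.inl j)))
    = ∑ i, M i j • basisVec n (blockIdx n k (Sum.inl i))
  apply_inr : ∀ l, A (basisVec n (blockIdx n k (Sum.inr l)))
    = basisVec n (blockIdx n k (Sum.inr l))

theorem basisVec_blockIdx_apply (i j : FinIdx n k ⊕ ℕ) :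
    basisVec n (blockIdx n k i) (blockIdx n k j) = if j = i then 1 else 0 := by
  simp [basisVec, Pi.single_apply, blockIdx_bijective.injective.eq_iff]

theorem ext_blockIdx {v v' : Hil n}
    (h : ∀ i, v (blockIdx n k i) = v' (blockIdx n k i)) : v = v' := by
  refine lp.ext (funext fun j => ?_)
  obtain ⟨i, rfl⟩ := (blockIdx_bijective (n := n) (k := k)).surjective j
  exact h i

theorem sum_smul_basisVec_blockIdx_apply (c : FinIdx n k → ℝ) (i : FinIdx n k ⊕ ℕ) :
    (∑ j, c j • basisVec n (blockIdx n k (Sum.inl j)) : Hil n) (blockIdx n k i)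
      = Sum.elim c (fun _ => 0) i := by
  simp only [lp.coeFn_sum, lp.coeFn_smul, Finset.sum_apply, Pi.smul_apply,
    basisVec_blockIdx_apply, smul_eq_mul]
  cases i <;> simp

/-- Since `blockIdx` exhausts the basis, the matrix of `A` determines its columns. -/
theorem FinData.IsRep.isFiniteBlock {D : FinData n k} {A : Hil n →L[ℝ] Hil n}
    (h : D.IsRep A) : IsFiniteBlock D.finG A where
  apply_inl j := by
    refine ext_blockIdx (k := k) fun i => ?_
    rw [sum_smul_basisVec_blockIdx_apply]
    refine (h i (Sum.inl j)).trans ?_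
    cases i <;> simp
  apply_inr l := by
    refine ext_blockIdx (k := k) fun i => ?_
    rw [basisVec_blockIdx_apply]
    refine (h i (Sum.inr l)).trans ?_
    cases i <;> simp [Matrix.one_apply]

namespace IsFiniteBlock

variable {M : Matrix (FinIdx n k) (FinIdx n k) ℝ}

theorem apply_sum {A : Hil n →L[ℝ] Hil n} (h : IsFiniteBlock M A) (c : FinIdx n k → ℝ) :
    A (∑ j, c j • basisVec n (blockIdx n k (Sum.inl j)))
      = ∑ i, (M *ᵥ c) i • basisVec n (blockIdx n k (Sum.inl i)) := by
  simp only [map_sum, map_smul, h.apply_inl, Finset.smul_sum, Matrix.mulVec, dotProduct,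
    Finset.sum_smul, smul_smul]
  rw [Finset.sum_comm]
  exact Finset.sum_congr rfl fun i _ => Finset.sum_congr rfl fun j _ => by rw [mul_comm]

/-- A kernel vector of the finite part would be a kernel vector of the invertible operator. -/
theorem det_ne_zero {A : (Hil n →L[ℝ] Hil n)ˣ}
    (h : IsFiniteBlock M (A : Hil n →L[ℝ] Hil n)) : M.det ≠ 0 := by
  intro h0
  obtain ⟨c, hc, hMc⟩ := Matrix.exists_mulVec_eq_zero_iff.2 h0
  have h1 := h.apply_sum c
  rw [hMc] at h1
  have h2 : (∑ j, c j • basisVec n (blockIdx n k (Sum.inl j)) : Hil n) = 0 := by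
    have := congrArg ((A⁻¹ : (Hil n →L[ℝ] Hil n)ˣ) : Hil n →L[ℝ] Hil n) h1
    rw [← mul_apply_eq_comp, A.inv_mul] at this
    simpa using this
  refine hc (funext fun i => ?_)
  have h3 := sum_smul_basisVec_blockIdx_apply c (Sum.inl i)
  rw [h2] at h3
  simpa using h3.symm

theorem inv {A : (Hil n →L[ℝ] Hil n)ˣ} (h : IsFiniteBlock M (A : Hil n →L[ℝ] Hil n)) :
    IsFiniteBlock M⁻¹ ((A⁻¹ : (Hil n →L[ℝ] Hil n)ˣ) : Hil n →L[ℝ] Hil n) := by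
  have hu : ∀ v v' : Hil n, (A : Hil n →L[ℝ] Hil n) v = v' →
      ((A⁻¹ : (Hil n →L[ℝ] Hil n)ˣ) : Hil n →L[ℝ] Hil n) v' = v := by
    rintro v _ rfl
    rw [← mul_apply_eq_comp, A.inv_mul]; rfl
  refine ⟨fun j => hu _ _ ?_, fun l => hu _ _ (h.apply_inr l)⟩
  rw [h.apply_sum fun i => M⁻¹ i j]
  have e : M *ᵥ (fun i => M⁻¹ i j) = fun i => (1 : Matrix (FinIdx n k) (FinIdx n k) ℝ) i j := by
    rw [← Matrix.mul_nonsing_inv M (isUnit_iff_ne_zero.2 h.det_ne_zero)]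
    rfl
  rw [e]
  simp [Matrix.one_apply]

end IsFiniteBlock

/-- The coordinates of a point of `ℝ^{n+∞}`, separated into the finite part and the rest. -/
def blockCoords (k : ℕ) (w : RNInf n) : (FinIdx n k → ℝ) × (ℕ → ℝ) :=
  (fun i => coords w (blockIdx n k (Sum.inl i)), fun l => coords w (blockIdx n k (Sum.inr l)))

theorem measurable_blockCoords : Measurable (blockCoords (n := n) k) :=
  Measurable.prodMk (measurable_pi_iff.2 fun _ => measurable_coords_apply _)
    (measurable_pi_iff.2 fun _ => measurable_coords_apply _)

theorem map_blockCoords_gaussNInf :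
    (gaussNInf n).map (blockCoords k) = (Measure.pi (fun _ : FinIdx n k => gaussianReal 0 1)).prod
      (Measure.infinitePi (fun _ : ℕ => gaussianReal 0 1)) := by
  have hm : Measurable fun f : FinIdx n k ⊕ ℕ → ℝ =>
      (fun i => f (Sum.inl i), fun l => f (Sum.inr l)) := by fun_prop
  have hr : Measurable fun (f : Fin n ⊕ ℕ → ℝ) (i : FinIdx n k ⊕ ℕ) => f (blockIdx n k i) := by
    fun_prop
  have e : blockCoords (n := n) k = (fun f : FinIdx n k ⊕ ℕ → ℝ =>
      ((fun i => f (Sum.inl i), fun l => f (Sum.inr l)) : (FinIdx n k → ℝ) × (ℕ → ℝ)))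
      ∘ (fun (f : Fin n ⊕ ℕ → ℝ) (i : FinIdx n k ⊕ ℕ) => f (blockIdx n k i)) ∘ coords := rfl
  rw [e, ← Measure.map_map hm (hr.comp measurable_coords), ← Measure.map_map hr measurable_coords,
    map_coords_gaussNInf, Measure.map_infinitePi_infinitePi_of_inj blockIdx_bijective.injective,
    ← map_sumElim_prod_infinitePi, Measure.map_map hm measurable_sumElim,
    ← Measure.infinitePi_eq_pi]
  exact Measure.map_id

theorem measure_ext_blockCoords {μ ν : Measure (RNInf n)}
    (h : μ.map (blockCoords k) = ν.map (blockCoords k)) : μ = ν := by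
  refine measure_ext_coords ?_
  let σ := Equiv.ofBijective _ (blockIdx_bijective (n := n) (k := k))
  have hm : Measurable fun (p : (FinIdx n k → ℝ) × (ℕ → ℝ)) (i : Fin n ⊕ ℕ) =>
      (Sum.elim p.1 p.2 : FinIdx n k ⊕ ℕ → ℝ) (σ.symm i) :=
    measurable_pi_iff.2 fun i => measurable_pi_iff.1 measurable_sumElim _
  have e : coords (n := n) = (fun (p : (FinIdx n k → ℝ) × (ℕ → ℝ)) (i : Fin n ⊕ ℕ) =>
      (Sum.elim p.1 p.2 : FinIdx n k ⊕ ℕ → ℝ) (σ.symm i)) ∘ blockCoords k := by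
    funext w i
    obtain ⟨j, rfl⟩ := σ.surjective i
    simp only [Function.comp_apply, Equiv.symm_apply_apply]
    cases j <;> rfl
  rw [e, ← Measure.map_map hm measurable_blockCoords, h, Measure.map_map hm measurable_blockCoords]

theorem IsFiniteBlock.blockCoords_rowAct {M : Matrix (FinIdx n k) (FinIdx n k) ℝ}
    {A : Hil n →L[ℝ] Hil n} (h : IsFiniteBlock M A) (w : RNInf n) :
    blockCoords k (rowAct A w) = ((blockCoords k w).1 ᵥ* M, (blockCoords k w).2) := by
  refine Prod.ext (funext fun j => ?_) (funext fun l => ?_)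
  · refine (coords_rowAct A w (blockIdx n k (Sum.inl j))).trans ?_
    rw [h.apply_inl,
      pairing_sum_smul_basisVec (fun i => blockIdx n k (Sum.inl i)) fun i => M i j]
    simp [Matrix.vecMul, dotProduct, blockCoords, mul_comm]
  · refine (coords_rowAct A w (blockIdx n k (Sum.inr l))).trans ?_
    rw [h.apply_inr, pairing_basisVec]
    rfl

theorem map_withDensity_comp {α β : Type*} [MeasurableSpace α] [MeasurableSpace β]
    {μ : Measure α} {f : α → β} (hf : Measurable f) {g : β → ℝ≥0∞} (hg : Measurable g) :
    (μ.withDensity fun a => g (f a)).map f = (μ.map f).withDensity g := by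
  refine Measure.ext_of_lintegral _ fun F hF => ?_
  have hgf : Measurable fun a => g (f a) := hg.comp hf
  have hFf : Measurable fun a => F (f a) := hF.comp hf
  rw [lintegral_map hF hf, lintegral_withDensity_eq_lintegral_mul _ hgf hFf,
    lintegral_withDensity_eq_lintegral_mul _ hg hF, lintegral_map (hg.mul hF) hf]
  rfl

/-- For an operator of finite size the measure `μ(EA)` has the expected Gaussian density. -/
theorem IsFiniteBlock.map_rowAct_inv {M : Matrix (FinIdx n k) (FinIdx n k) ℝ}
    {A : (Hil n →L[ℝ] Hil n)ˣ} (h : IsFiniteBlock M (A : Hil n →L[ℝ] Hil n)) :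
    (gaussNInf n).map (rowAct ((A⁻¹ : (Hil n →L[ℝ] Hil n)ˣ) : Hil n →L[ℝ] Hil n))
      = (gaussNInf n).withDensity fun w => ENNReal.ofReal (linDer M (blockCoords k w).1) := by
  have hl := (measurable_linDer M).ennreal_ofReal
  have hv := measurable_vecMul M⁻¹
  refine measure_ext_blockCoords (k := k) ?_
  rw [map_withDensity_comp (g := fun p : (FinIdx n k → ℝ) × (ℕ → ℝ) =>
    ENNReal.ofReal (linDer M p.1)) measurable_blockCoords (hl.comp measurable_fst),
    map_blockCoords_gaussNInf, ← prod_withDensity_left hl, ← map_vecMul_inv_pi_gaussianReal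
      h.det_ne_zero, Measure.map_map measurable_blockCoords (measurable_rowAct _)]
  have e : blockCoords k ∘ rowAct ((A⁻¹ : (Hil n →L[ℝ] Hil n)ˣ) : Hil n →L[ℝ] Hil n)
      = Prod.map (fun z => z ᵥ* M⁻¹) id ∘ blockCoords k :=
    funext fun w => h.inv.blockCoords_rowAct w
  rw [e, ← Measure.map_map (hv.prodMap measurable_id) measurable_blockCoords,
    map_blockCoords_gaussNInf, ← Measure.map_prod_map _ _ hv measurable_id, Measure.map_id]

/-- Applied to `A⁻¹`, the density formula shows that `w ↦ wA` does not charge null sets. -/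
theorem IsFiniteBlock.quasiMeasurePreserving {M : Matrix (FinIdx n k) (FinIdx n k) ℝ}
    {A : (Hil n →L[ℝ] Hil n)ˣ} (h : IsFiniteBlock M (A : Hil n →L[ℝ] Hil n)) :
    Measure.QuasiMeasurePreserving (rowAct (A : Hil n →L[ℝ] Hil n))
      (gaussNInf n) (gaussNInf n) := by
  refine ⟨measurable_rowAct _, ?_⟩
  have := h.inv.map_rowAct_inv
  rw [inv_inv] at this
  rw [this]
  exact withDensity_absolutelyContinuous _ _

/-! ### Measurability on the group `ℝ^×` -/

instance : MeasurableMul₂ PosReal :=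
  ⟨Measurable.subtype_mk (by fun_prop)⟩

instance : MeasurableInv PosReal :=
  ⟨Measurable.subtype_mk (by fun_prop)⟩

theorem measurable_toPos : Measurable toPos := by
  have h : Measurable fun r => (toPos r : ℝ) := by
    have e : (fun r => (toPos r : ℝ)) = fun r : ℝ => if 0 < r then r else 1 := by
      funext r
      by_cases h : 0 < r <;> simp [toPos, h]
    rw [e]
    exact Measurable.ite measurableSet_Ioi measurable_id measurable_const
  exact h.subtype_mk (h := fun r => (toPos r).2)

theorem coe_toPos {r : ℝ} (hr : 0 < r) : (toPos r : ℝ) = r := by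
  simp [toPos, hr]

/-! ### Products with polymorphisms concentrated on graphs -/

/-- A product with a polymorphism concentrated on the graph of a map: the disintegration consists
of point masses. Absolute continuity is needed because the disintegration is determined only up to
`ν`-null sets. -/
theorem comp_map_graph {M N K : Type*} [MeasurableSpace M] [MeasurableSpace N] [MeasurableSpace K]
    [StandardBorelSpace K] [Nonempty K] {P : Measure (M × N × PosReal)} [IsFiniteMeasure P]
    {ν : Measure N} [IsFiniteMeasure ν] {f : N → K × PosReal} (hf : Measurable f)
    {Q : Measure (N × K × PosReal)} [IsFiniteMeasure Q] (hQ : Q = ν.map fun y => (y, f y))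
    (hac : P.map (fun z => z.2.1) ≪ ν) :
    comp P Q = P.map fun z => (z.1, (f z.2.1).1, z.2.2 * (f z.2.1).2) := by
  have h2 : Measurable fun z : M × N × PosReal => z.2.1 := measurable_fst.comp measurable_snd
  have hfst : Q.fst = ν := by
    rw [hQ, Measure.fst, Measure.map_map (g := Prod.fst) (f := fun y => (y, f y))
      measurable_fst (by fun_prop)]
    exact Measure.map_id
  have hQ' : Q = Q.fst ⊗ₘ Kernel.deterministic f hf := by
    rw [Measure.compProd_deterministic, hfst, hQ]
  have hae : ∀ᵐ y ∂ν, Kernel.deterministic f hf y = Q.condKernel y := by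
    have := eq_condKernel_of_measure_eq_compProd (ρ := Q) _ hQ'
    rwa [hfst] at this
  have hae2 : ∀ᵐ z ∂P, Kernel.deterministic f hf z.2.1 = Q.condKernel z.2.1 :=
    ae_of_ae_map h2.aemeasurable (hac.ae_le hae)
  have hk : P ⊗ₘ (Q.condKernel.comap (fun z : M × N × PosReal => z.2.1) h2)
      = P ⊗ₘ Kernel.deterministic (fun z : M × N × PosReal => f z.2.1) (hf.comp h2) := by
    refine Measure.compProd_congr ?_
    filter_upwards [hae2] with z hz
    rw [Kernel.comap_apply, ← hz, Kernel.deterministic_apply, Kernel.deterministic_apply]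
  rw [comp, hk, Measure.compProd_deterministic, Measure.map_map (by fun_prop) (by fun_prop)]
  rfl

theorem measurable_rnDer (A : (Hil n →L[ℝ] Hil n)ˣ) : Measurable (rnDer A) :=
  measurable_toPos.comp (Measure.measurable_rnDeriv _ _).ennreal_toReal

theorem star_lPoly : star (lPoly n) = (gaussNInf n).map fun w => (w, w.1, (1 : PosReal)) := by
  have hm : Measurable fun w : RNInf n => ((w.1, w, 1) : RN n × RNInf n × PosReal) := by fun_prop
  have h : timesT (lPoly n) = lPoly n := by
    rw [timesT, lPoly, ← map_withDensity_comp hm (by fun_prop)]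
    simp
  rw [star, h, lPoly, Measure.map_map (by fun_prop) hm]
  congr 1
  funext w
  simp

/-- The value `τ(𝔞)` is the joint law of `x`, of the first component of `(x, y)A`, and of the
Radon–Nikodym derivative of `(x, y) ↦ (x, y)A`. -/
theorem tau_eq_map (A : GLO n) (hA : Measure.QuasiMeasurePreserving
    (rowAct ((A : (Hil n →L[ℝ] Hil n)ˣ) : Hil n →L[ℝ] Hil n)) (gaussNInf n) (gaussNInf n)) :
    tau A = (gaussNInf n).map fun w =>
      (w.1, (rowAct ((A : (Hil n →L[ℝ] Hil n)ˣ) : Hil n →L[ℝ] Hil n) w).1,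
        rnDer (A : (Hil n →L[ℝ] Hil n)ˣ) w) := by
  have hr := measurable_rowAct ((A : (Hil n →L[ℝ] Hil n)ˣ) : Hil n →L[ℝ] Hil n)
  have hd := measurable_rnDer (A : (Hil n →L[ℝ] Hil n)ˣ)
  have : IsFiniteMeasure (lPoly n) := by unfold lPoly; infer_instance
  have h1 : comp (lPoly n) (polyOf (A : (Hil n →L[ℝ] Hil n)ˣ)) = (gaussNInf n).map fun w =>
      (w.1, rowAct ((A : (Hil n →L[ℝ] Hil n)ˣ) : Hil n →L[ℝ] Hil n) w,
        rnDer (A : (Hil n →L[ℝ] Hil n)ˣ) w) := by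
    rw [comp_map_graph (ν := gaussNInf n) (hr.prodMk hd) (by rfl), lPoly,
      Measure.map_map (by fun_prop) (by fun_prop)]
    · simp [Function.comp_def]
    · rw [lPoly, Measure.map_map (by fun_prop) (by fun_prop)]
      exact Measure.absolutelyContinuous_of_eq Measure.map_id
  have : IsFiniteMeasure (comp (lPoly n) (polyOf (A : (Hil n →L[ℝ] Hil n)ˣ))) := by
    rw [h1]; infer_instance
  rw [tau, comp_map_graph (ν := gaussNInf n) (f := fun w => (w.1, 1)) (by fun_prop) star_lPoly]
  · rw [h1, Measure.map_map (by fun_prop) (by fun_prop)]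
    simp [Function.comp_def]
  · rw [h1, Measure.map_map (by fun_prop) (by fun_prop)]
    exact hA.absolutelyContinuous

/-! ### Reduction of an arbitrary representative to the finite one -/

/-- If `A = UGV` with `U, V ∈ O(∞)` and `G` of finite size, then the orthogonal change of variables
`w ↦ wU` turns the law defining `τ` into the one computed from the finite part of `G`. -/
theorem tau_eq_of_doubleCoset (A : GLO n) {G U V : (Hil n →L[ℝ] Hil n)ˣ}
    (hAG : (A : (Hil n →L[ℝ] Hil n)ˣ) = U * G * V) (hU : U ∈ OInf n) (hV : V ∈ OInf n)
    {M : Matrix (FinIdx n k) (FinIdx n k) ℝ}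
    (hG : IsFiniteBlock M (G : Hil n →L[ℝ] Hil n)) :
    tau A = (gaussNInf n).map fun w => (w.1,
      fun i => ((blockCoords k w).1 ᵥ* M) (Sum.inl i), toPos (linDer M (blockCoords k w).1)) := by
  have pU := measurePreserving_rowAct hU.1
  have pV := measurePreserving_rowAct hV.1
  have qG := hG.quasiMeasurePreserving
  have mU := measurable_rowAct (U : Hil n →L[ℝ] Hil n)
  have ml : Measurable fun w : RNInf n => linDer M (blockCoords k w).1 :=
    (measurable_linDer M).comp (measurable_fst.comp measurable_blockCoords)
  -- the action of `A` factors almost everywhere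
  have hfac : ∀ᵐ w ∂(gaussNInf n),
      rowAct ((A : (Hil n →L[ℝ] Hil n)ˣ) : Hil n →L[ℝ] Hil n) w
        = rowAct (V : Hil n →L[ℝ] Hil n) (rowAct (G : Hil n →L[ℝ] Hil n)
            (rowAct (U : Hil n →L[ℝ] Hil n) w)) := by
    filter_upwards [rowAct_mul_ae pU.quasiMeasurePreserving
      ((G : Hil n →L[ℝ] Hil n) * (V : Hil n →L[ℝ] Hil n)),
      pU.quasiMeasurePreserving.ae (rowAct_mul_ae qG (V : Hil n →L[ℝ] Hil n))] with w h1 h2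
    rw [hAG, Units.val_mul, Units.val_mul, mul_assoc, h1, h2]
  have hqA : Measure.QuasiMeasurePreserving
      (rowAct ((A : (Hil n →L[ℝ] Hil n)ˣ) : Hil n →L[ℝ] Hil n)) (gaussNInf n) (gaussNInf n) := by
    refine ⟨measurable_rowAct _, ?_⟩
    rw [Measure.map_congr hfac]
    exact ((pV.quasiMeasurePreserving.comp qG).comp
      pU.quasiMeasurePreserving).absolutelyContinuous
  -- the inverse images of the Gaussian measure
  have pV' := measurePreserving_rowAct (inv_mem hV).1
  have pU' := measurePreserving_rowAct (inv_mem hU).1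
  have hVG : (gaussNInf n).map (rowAct (((G * V)⁻¹ : (Hil n →L[ℝ] Hil n)ˣ) :
      Hil n →L[ℝ] Hil n))
      = (gaussNInf n).withDensity fun w => ENNReal.ofReal (linDer M (blockCoords k w).1) := by
    rw [← hG.map_rowAct_inv, mul_inv_rev, Units.val_mul,
      Measure.map_congr (rowAct_mul_ae pV'.quasiMeasurePreserving _)]
    conv_rhs => rw [← pV'.map_eq, Measure.map_map (measurable_rowAct _) (measurable_rowAct _)]
    rfl
  have qVG : Measure.QuasiMeasurePreserving (rowAct (((G * V)⁻¹ : (Hil n →L[ℝ] Hil n)ˣ) :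
      Hil n →L[ℝ] Hil n)) (gaussNInf n) (gaussNInf n) :=
    ⟨measurable_rowAct _, by rw [hVG]; exact withDensity_absolutelyContinuous _ _⟩
  have hcancel : ∀ᵐ w ∂(gaussNInf n), rowAct (U : Hil n →L[ℝ] Hil n)
      (rowAct ((U⁻¹ : (Hil n →L[ℝ] Hil n)ˣ) : Hil n →L[ℝ] Hil n) w) = w := by
    filter_upwards [rowAct_mul_ae pU'.quasiMeasurePreserving (U : Hil n →L[ℝ] Hil n)] with w hw
    rw [← hw, Units.inv_mul, rowAct_one]
  have hcancel' : (gaussNInf n).withDensity (fun w => ENNReal.ofReal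
      (linDer M (blockCoords k w).1)) = (gaussNInf n).withDensity (fun w => ENNReal.ofReal
      (linDer M (blockCoords k (rowAct (U : Hil n →L[ℝ] Hil n)
      (rowAct ((U⁻¹ : (Hil n →L[ℝ] Hil n)ˣ) : Hil n →L[ℝ] Hil n) w))).1)) :=
    withDensity_congr_ae (by filter_upwards [hcancel] with w hw; rw [hw])
  have hden : (gaussNInf n).map (rowAct ((((A : (Hil n →L[ℝ] Hil n)ˣ))⁻¹ :
      (Hil n →L[ℝ] Hil n)ˣ) : Hil n →L[ℝ] Hil n)) = (gaussNInf n).withDensity fun w =>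
        ENNReal.ofReal (linDer M (blockCoords k (rowAct (U : Hil n →L[ℝ] Hil n) w)).1) := by
    have e : (((A : (Hil n →L[ℝ] Hil n)ˣ))⁻¹ : (Hil n →L[ℝ] Hil n)ˣ) = (G * V)⁻¹ * U⁻¹ := by
      rw [hAG]; group
    rw [e, Units.val_mul, Measure.map_congr (rowAct_mul_ae qVG _)]
    have := Measure.map_map (μ := gaussNInf n) (measurable_rowAct
      ((U⁻¹ : (Hil n →L[ℝ] Hil n)ˣ) : Hil n →L[ℝ] Hil n)) (measurable_rowAct
      (((G * V)⁻¹ : (Hil n →L[ℝ] Hil n)ˣ) : Hil n →L[ℝ] Hil n))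
    rw [hVG, hcancel', map_withDensity_comp (g := fun w => ENNReal.ofReal
      (linDer M (blockCoords k (rowAct (U : Hil n →L[ℝ] Hil n) w)).1)) (measurable_rowAct _)
      (ml.comp mU).ennreal_ofReal, pU'.map_eq] at this
    exact this.symm
  have hder : ∀ᵐ w ∂(gaussNInf n), rnDer (A : (Hil n →L[ℝ] Hil n)ˣ) w
      = toPos (linDer M (blockCoords k (rowAct (U : Hil n →L[ℝ] Hil n) w)).1) := by
    have := Measure.rnDeriv_withDensity (gaussNInf n) (ml.comp mU).ennreal_ofReal
    filter_upwards [this] with w hw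
    rw [rnDer, hden]
    erw [hw]
    rw [Function.comp_apply, ENNReal.toReal_ofReal (linDer_pos hG.det_ne_zero _).le]
  have mv := measurable_vecMul M
  have mb := measurable_blockCoords (n := n) (k := k)
  have mt := measurable_toPos.comp ml
  have mF : Measurable fun w : RNInf n => (w.1,
      fun i => ((blockCoords k w).1 ᵥ* M) (Sum.inl i),
      toPos (linDer M (blockCoords k w).1)) := by
    refine Measurable.prodMk (by fun_prop) (Measurable.prodMk ?_ mt)
    have mz : Measurable fun w : RNInf n => (blockCoords k w).1 ᵥ* M :=
      mv.comp (measurable_fst.comp mb)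
    exact measurable_pi_iff.2 fun i => measurable_pi_iff.1 mz (Sum.inl i)
  rw [tau_eq_map A hqA]
  conv_rhs => rw [← pU.map_eq, Measure.map_map mF mU]
  refine Measure.map_congr ?_
  filter_upwards [hfac, hder] with w h1 h2
  rw [h1, h2, rowAct_fst_of_mem_OInf hV]
  refine Prod.ext (rowAct_fst_of_mem_OInf hU w).symm (Prod.ext ?_ rfl)
  funext i
  have := congrArg (fun p => p.1 (Sum.inl i)) (hG.blockCoords_rowAct (rowAct
    (U : Hil n →L[ℝ] Hil n) w))
  exact this

/-! ### The measures `Φ[b, M]` as Gaussian images -/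

theorem lintegral_eq_setLIntegral_Ioi_add_neg (g : ℝ → ℝ≥0∞) (hg : Measurable g) :
    ∫⁻ r, g r = ∫⁻ r in Set.Ioi 0, (g r + g (-r)) := by
  rw [lintegral_add_left hg, ← lintegral_add_compl g (measurableSet_Ioi (a := (0 : ℝ)))]
  congr 1
  have h := (Measure.measurePreserving_neg (volume : Measure ℝ)).setLIntegral_comp_preimage
    (s := Set.Iio 0) measurableSet_Iio hg
  have e : (Neg.neg ⁻¹' Set.Iio (0 : ℝ)) = Set.Ioi 0 := by ext; simp
  rw [e] at h
  rw [h, Set.compl_Ioi]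
  exact setLIntegral_congr Iio_ae_eq_Iic.symm

/-- The density of `Φ[b, M]` with respect to Lebesgue measure. -/
def phiDensity (b M t : ℝ) : ℝ :=
  (Real.sqrt Real.pi)⁻¹ * t ^ (1 / b) * (Real.sqrt (-(b * Real.log t)))⁻¹ *
    Real.cosh (Real.sqrt (-(4 * M / b * Real.log t))) / t

theorem measurable_phiDensity (b M : ℝ) : Measurable (phiDensity b M) := by
  unfold phiDensity; fun_prop

/-- The substitution `r = √(-2 b⁻¹ ln t)` turns `Φ[b, m²/2]` into the even part of a shifted
Gaussian density. -/
theorem lintegral_Phi {b : ℝ} (hb : b ≠ 0) (m : ℝ) {f : PosReal → ℝ≥0∞} (hf : Measurable f) :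
    ∫⁻ t, f t ∂(Phi b (m ^ 2 / 2)) = ∫⁻ r in Set.Ioi (0 : ℝ),
      ENNReal.ofReal (Real.sqrt 2 / Real.sqrt Real.pi * Real.exp (-r ^ 2 / 2) * Real.cosh (r * m))
        * f (toPos (Real.exp (-(b / 2) * r ^ 2))) := by
  set E : ℝ → ℝ := fun r => Real.exp (-(b / 2) * r ^ 2) with hE
  have hE' : ∀ r ∈ Set.Ioi (0 : ℝ), HasDerivWithinAt E (-(b * r) * E r) (Set.Ioi 0) r := by
    intro r _
    have h1 : HasDerivAt (fun r : ℝ => -(b / 2) * r ^ 2) (-(b * r)) r := by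
      have := (hasDerivAt_pow 2 r).const_mul (-(b / 2))
      refine this.congr_deriv ?_
      push_cast; ring
    refine (h1.exp.congr_deriv ?_).hasDerivWithinAt
    simp [hE]; ring
  have hinj : Set.InjOn E (Set.Ioi 0) := by
    intro r hr s hs h
    have h1 := Real.exp_injective h
    have h2 : r ^ 2 = s ^ 2 := mul_left_cancel₀ (neg_ne_zero.2 (div_ne_zero hb two_ne_zero)) h1
    exact (pow_left_inj₀ (le_of_lt hr) (le_of_lt hs) two_ne_zero).1 h2
  have himg : E '' Set.Ioi 0 = {t : ℝ | 0 < t ∧ b * Real.log t < 0} := by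
    ext t
    constructor
    · rintro ⟨r, hr, rfl⟩
      refine ⟨Real.exp_pos _, ?_⟩
      have hr' : 0 < r := hr
      simp only [hE, Real.log_exp]
      have : 0 < b ^ 2 * r ^ 2 := by positivity
      nlinarith
    · rintro ⟨ht, hbt⟩
      have hpos : 0 < -(2 / b) * Real.log t := by
        have : -(2 / b) * Real.log t = 2 / b ^ 2 * -(b * Real.log t) := by field_simp
        rw [this]
        have : 0 < -(b * Real.log t) := by linarith
        positivity
      refine ⟨Real.sqrt (-(2 / b) * Real.log t), Real.sqrt_pos.2 hpos, ?_⟩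
      simp only [hE]
      rw [Real.sq_sqrt hpos.le,
        show -(b / 2) * (-(2 / b) * Real.log t) = Real.log t by field_simp, Real.exp_log ht]
  have hS : MeasurableSet {t : ℝ | 0 < t ∧ b * Real.log t < 0} :=
    measurableSet_Ioi.inter (measurableSet_lt (f := fun t : ℝ => b * Real.log t)
      (Real.measurable_log.const_mul b) measurable_const)
  have hden := (measurable_phiDensity b (m ^ 2 / 2)).ennreal_ofReal
  have hPhi : Phi b (m ^ 2 / 2) = (Measure.comap Subtype.val (volume : Measure ℝ)).withDensity
      (fun t : PosReal => Set.indicator {t : ℝ | 0 < t ∧ b * Real.log t < 0}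
        (fun t => ENNReal.ofReal (phiDensity b (m ^ 2 / 2) t)) t) := by
    rw [Phi, if_neg hb]
    congr 1
    funext t
    simp only [Set.indicator, Set.mem_ofPred_eq, t.2, true_and]
    rfl
  have htp : ∀ t : PosReal, toPos (t : ℝ) = t := fun t => Subtype.ext (coe_toPos t.2)
  have hind : Measurable (Set.indicator {t : ℝ | 0 < t ∧ b * Real.log t < 0}
        (fun t => ENNReal.ofReal (phiDensity b (m ^ 2 / 2) t))) := hden.indicator hS
  have hind' : Measurable fun t : PosReal => Set.indicator {t : ℝ | 0 < t ∧ b * Real.log t < 0}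
        (fun t => ENNReal.ofReal (phiDensity b (m ^ 2 / 2) t)) t :=
    hind.comp measurable_subtype_coe
  calc ∫⁻ t, f t ∂(Phi b (m ^ 2 / 2))
      = ∫⁻ t : PosReal, Set.indicator {t : ℝ | 0 < t ∧ b * Real.log t < 0}
        (fun t => ENNReal.ofReal (phiDensity b (m ^ 2 / 2) t) * f (toPos t)) t
          ∂(Measure.comap Subtype.val (volume : Measure ℝ)) := by
        rw [hPhi, lintegral_withDensity_eq_lintegral_mul _ hind' hf]
        refine lintegral_congr fun t => ?_
        by_cases h : (t : ℝ) ∈ {t : ℝ | 0 < t ∧ b * Real.log t < 0} <;>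
          simp [Set.indicator, htp]
    _ = ∫⁻ t in Set.Ioi (0 : ℝ), Set.indicator {t : ℝ | 0 < t ∧ b * Real.log t < 0}
        (fun t => ENNReal.ofReal (phiDensity b (m ^ 2 / 2) t) * f (toPos t)) t :=
        lintegral_subtype_comap measurableSet_Ioi _
    _ = ∫⁻ t in E '' Set.Ioi 0, ENNReal.ofReal (phiDensity b (m ^ 2 / 2) t) * f (toPos t) := by
        rw [lintegral_indicator hS, Measure.restrict_restrict hS, himg]
        congr 2
        ext t
        simp only [Set.mem_inter_iff, Set.mem_ofPred_eq, Set.mem_Ioi]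
        tauto
    _ = _ := by
        rw [lintegral_image_eq_lintegral_abs_deriv_mul measurableSet_Ioi hE' hinj]
        refine setLIntegral_congr_fun measurableSet_Ioi fun r hr => ?_
        have hr' : 0 < r := hr
        have hEp : 0 < E r := Real.exp_pos _
        rw [← mul_assoc, ← ENNReal.ofReal_mul (abs_nonneg _)]
        congr 2
        have hlog : Real.log (E r) = -(b / 2) * r ^ 2 := Real.log_exp _
        have hb' : 0 < |b| := abs_pos.2 hb
        have h1 : Real.sqrt (-(b * Real.log (E r))) = |b| * r / Real.sqrt 2 := by
          rw [hlog, show -(b * (-(b / 2) * r ^ 2)) = (|b| * r) ^ 2 / 2 by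
            rw [mul_pow, sq_abs]; ring, Real.sqrt_div (sq_nonneg _), Real.sqrt_sq (by positivity)]
        have h2 : Real.cosh (Real.sqrt (-(4 * (m ^ 2 / 2) / b * Real.log (E r))))
            = Real.cosh (r * m) := by
          rw [hlog, show -(4 * (m ^ 2 / 2) / b * (-(b / 2) * r ^ 2)) = (r * m) ^ 2 by
            field_simp; ring, Real.sqrt_sq_eq_abs, Real.cosh_abs]
        have h3 : E r ^ (1 / b) = Real.exp (-r ^ 2 / 2) := by
          rw [Real.rpow_def_of_pos hEp, hlog]
          congr 1
          field_simp
        rw [phiDensity, h1, h2, h3, abs_mul, abs_neg, abs_mul, abs_of_pos hr', abs_of_pos hEp]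
        field_simp

/-- The image of the standard Gaussian measure under `s ↦ exp(-½ b (s - m)²)`. -/
theorem map_gaussianReal_exp_eq_Phi {b : ℝ} (hb : b ≠ 0) (m : ℝ) :
    (gaussianReal 0 1).map (fun s => toPos (Real.exp (-(b / 2) * (s - m) ^ 2)))
      = ENNReal.ofReal (Real.exp (-m ^ 2 / 2)) • Phi b (m ^ 2 / 2) := by
  have hm : Measurable fun s => toPos (Real.exp (-(b / 2) * (s - m) ^ 2)) :=
    measurable_toPos.comp (by fun_prop)
  refine Measure.ext_of_lintegral _ fun f hf => ?_
  have hfm : Measurable fun s => f (toPos (Real.exp (-(b / 2) * (s - m) ^ 2))) := hf.comp hm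
  have hp := measurable_gaussianPDF 0 1
  rw [lintegral_map hf hm, lintegral_smul_measure, lintegral_Phi hb m hf, smul_eq_mul,
    gaussianReal_of_var_ne_zero _ one_ne_zero,
    lintegral_withDensity_eq_lintegral_mul _ hp hfm,
    ← lintegral_add_right_eq_self _ m, lintegral_eq_setLIntegral_Ioi_add_neg,
    ← lintegral_const_mul' _ _ ENNReal.ofReal_ne_top]
  · refine lintegral_congr fun r => ?_
    simp only [Pi.mul_apply, add_sub_cancel_right, even_two.neg_pow, gaussianPDF]
    rw [← add_mul, ← ENNReal.ofReal_add (gaussianPDFReal_nonneg _ _ _)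
      (gaussianPDFReal_nonneg _ _ _), ← mul_assoc, ← ENNReal.ofReal_mul (Real.exp_pos _).le]
    congr 2
    simp only [gaussianPDFReal, NNReal.coe_one, mul_one, sub_zero]
    rw [Real.cosh_eq, show -(r + m) ^ 2 / 2 = -m ^ 2 / 2 + -r ^ 2 / 2 + -(r * m) by ring,
      show -(-r + m) ^ 2 / 2 = -m ^ 2 / 2 + -r ^ 2 / 2 + r * m by ring,
      Real.exp_add _ (-(r * m)), Real.exp_add _ (r * m), Real.exp_add, Real.sqrt_mul zero_le_two]
    have h2 : Real.sqrt 2 ^ 2 = 2 := Real.sq_sqrt zero_le_two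
    have h3 : Real.sqrt 2 ≠ 0 := by positivity
    have h4 : Real.sqrt Real.pi ≠ 0 := by positivity
    field_simp
    rw [h2]; ring
  · exact (hp.mul hfm).comp (measurable_add_const m)

/-- The total mass of `Φ[b, m²/2]` is `exp(m²/2)`, so the measure is finite. -/
theorem Phi_eq_smul_map {b : ℝ} (hb : b ≠ 0) (m : ℝ) :
    Phi b (m ^ 2 / 2) = ENNReal.ofReal (Real.exp (m ^ 2 / 2)) •
      (gaussianReal 0 1).map (fun s => toPos (Real.exp (-(b / 2) * (s - m) ^ 2))) := by
  rw [map_gaussianReal_exp_eq_Phi hb, smul_smul, ← ENNReal.ofReal_mul (Real.exp_pos _).le,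
    ← Real.exp_add]
  simp [neg_div]

/-! ### The algebra of the finite block -/

theorem toPos_mul {r s : ℝ} (hr : 0 < r) (hs : 0 < s) : toPos (r * s) = toPos r * toPos s :=
  Subtype.ext (by rw [coe_toPos (mul_pos hr hs)]; simp [coe_toPos, hr, hs])

theorem toPos_prod {ι : Type*} (s : Finset ι) {f : ι → ℝ} (hf : ∀ i, 0 < f i) :
    toPos (∏ i ∈ s, f i) = ∏ i ∈ s, toPos (f i) := by
  classical
  induction s using Finset.induction_on with
  | empty => exact Subtype.ext (by rw [Finset.prod_empty, coe_toPos one_pos]; rfl)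
  | insert a s ha ih =>
    rw [Finset.prod_insert ha, Finset.prod_insert ha,
      toPos_mul (hf a) (Finset.prod_pos fun i _ => hf i), ih]

namespace FinData

variable (D : FinData n k)

/-- The centre `h_j ψ_j / (1 - h_j²)` of the quadratic function of the `j`-th Gaussian variable
that enters the Radon–Nikodym derivative. -/
def centre (x u : RN n) (j : Fin k) : ℝ := D.h j * D.psi x u j / (1 - D.h j ^ 2)

theorem one_sub_H_mul_transpose : 1 - D.H * D.Hᵀ = Matrix.diagonal fun j => 1 - D.h j ^ 2 := by
  rw [H, Matrix.transpose_fromCols, Matrix.fromCols_mul_fromRows, Matrix.diagonal_transpose,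
    Matrix.diagonal_mul_diagonal]
  ext i j
  simp only [Matrix.transpose_zero, Matrix.mul_zero, zero_add, Matrix.sub_apply,
    Matrix.one_apply, Matrix.diagonal_apply, sq]
  split_ifs <;> simp

theorem one_sub_transpose_mul_H :
    1 - D.Hᵀ * D.H = Matrix.diagonal (Sum.elim (fun _ => 1) fun j => 1 - D.h j ^ 2) := by
  rw [H, Matrix.transpose_fromCols, Matrix.fromRows_mul_fromCols, Matrix.diagonal_transpose,
    Matrix.diagonal_mul_diagonal]
  ext i j
  rcases i with i | i <;> rcases j with j | j <;>
    simp [Matrix.one_apply, Matrix.diagonal_apply, sq]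
  split_ifs <;> simp

variable {D}

theorem vecMul_transpose_mul_inv (hh : ∀ j, D.h j ^ 2 ≠ 1) (x u : RN n) :
    D.v x u ᵥ* (D.Hᵀ * (1 - D.H * D.Hᵀ)⁻¹) = D.centre x u := by
  have h0 : ∀ j, 1 - D.h j ^ 2 ≠ 0 := fun j => sub_ne_zero.2 (hh j).symm
  rw [one_sub_H_mul_transpose, Matrix.inv_eq_right_inv (B := Matrix.diagonal fun j =>
    (1 - D.h j ^ 2)⁻¹) (by simp [h0]), ← Matrix.vecMul_vecMul]
  funext j
  rw [Matrix.vecMul_diagonal, H, Matrix.transpose_fromCols, Matrix.diagonal_transpose]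
  simp [Matrix.vecMul, dotProduct, centre, psi, div_eq_mul_inv, Matrix.diagonal_apply,
    mul_comm (D.h j)]

theorem vecMul_inv_dotProduct (hh : ∀ j, D.h j ^ 2 ≠ 1) (x u : RN n) :
    (D.v x u ᵥ* (1 - D.Hᵀ * D.H)⁻¹) ⬝ᵥ D.v x u
      = ∑ i, D.v x u (Sum.inl i) ^ 2 + ∑ j, D.psi x u j ^ 2 / (1 - D.h j ^ 2) := by
  have h0 : ∀ j, 1 - D.h j ^ 2 ≠ 0 := fun j => sub_ne_zero.2 (hh j).symm
  rw [one_sub_transpose_mul_H, Matrix.inv_eq_right_inv (B := Matrix.diagonal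
    (Sum.elim (fun _ => 1) fun j => (1 - D.h j ^ 2)⁻¹))]
  · simp only [dotProduct, Matrix.vecMul_diagonal, Fintype.sum_sum_type, Sum.elim_inl,
      Sum.elim_inr, psi]
    congr 1
    · exact Finset.sum_congr rfl fun i _ => by ring
    · exact Finset.sum_congr rfl fun j _ => by rw [div_eq_mul_inv]; ring
  · rw [Matrix.diagonal_mul_diagonal, ← Matrix.diagonal_one]
    congr 1
    funext i
    rcases i with i | i <;> simp [h0]

theorem vecMul_a_add_y_vecMul_c (hc : IsUnit D.c.det) (x u : RN n) :
    x ᵥ* D.a + D.y x u ᵥ* D.c = u := by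
  simp only [y, Q, T, Matrix.add_vecMul, Matrix.vecMul_vecMul, Matrix.neg_vecMul,
    Matrix.mul_assoc, Matrix.nonsing_inv_mul _ hc, Matrix.mul_one,
    Matrix.vecMul_one, Matrix.vecMul_neg]
  abel

theorem y_eq (x u : RN n) : D.y x u = (u - x ᵥ* D.a) ᵥ* D.c⁻¹ := by
  simp only [y, Q, T, Matrix.sub_vecMul, Matrix.vecMul_vecMul, Matrix.vecMul_neg]
  abel

theorem vecMul_b_add_y_vecMul_d (x u : RN n) :
    x ᵥ* D.b + D.y x u ᵥ* D.d = D.v x u := by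
  simp only [y, Q, T, v, P, R, Matrix.add_vecMul, Matrix.vecMul_vecMul, Matrix.neg_mul,
    Matrix.vecMul_sub, Matrix.mul_assoc]
  rw [Matrix.vecMul_neg]
  abel

theorem vecMul_finG (x y : RN n) (s : Fin k → ℝ) :
    Sum.elim x (Sum.elim y s) ᵥ* D.finG
      = Sum.elim (x ᵥ* D.a + y ᵥ* D.c) (x ᵥ* D.b + y ᵥ* D.d + s ᵥ* D.H) := by
  rw [finG, Matrix.vecMul_fromBlocks]
  simp [add_assoc]

/-- On the fibre over `(x, u)` the Radon–Nikodym derivative, as a function of the remaining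
Gaussian variables `s`, is obtained by completing the squares. -/
theorem linDer_finG (hc : IsUnit D.c.det) (hh : ∀ j, D.h j ^ 2 ≠ 1) (x u : RN n)
    (s : Fin k → ℝ) :
    linDer D.finG (Sum.elim x (Sum.elim (D.y x u) s)) = D.point x u *
      ∏ j, Real.exp (-((D.h j ^ 2 - 1) / 2) * (s j - D.centre x u j) ^ 2) := by
  have h0 : ∀ j, 1 - D.h j ^ 2 ≠ 0 := fun j => sub_ne_zero.2 (hh j).symm
  rw [linDer, vecMul_finG, vecMul_a_add_y_vecMul_c hc, vecMul_b_add_y_vecMul_d, point,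
    vecMul_inv_dotProduct hh, ← Real.exp_sum, mul_assoc, ← Real.exp_add]
  congr 2
  have hs : ∀ i, (s ᵥ* D.H) i = Sum.elim (fun _ => 0) (fun j => s j * D.h j) i := by
    rintro (i | j) <;> simp [H, Matrix.vecMul, dotProduct, Matrix.diagonal_apply]
  have hsq : (D.v x u + s ᵥ* D.H) ⬝ᵥ (D.v x u + s ᵥ* D.H)
      = ∑ i, D.v x u (Sum.inl i) ^ 2 + ∑ j, (D.psi x u j + s j * D.h j) ^ 2 := by
    simp only [dotProduct, Fintype.sum_sum_type, Pi.add_apply, hs, Sum.elim_inl, Sum.elim_inr,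
      add_zero, psi, sq]
  have hj : ∑ j, -((D.h j ^ 2 - 1) / 2) * (s j - D.centre x u j) ^ 2
      = 1 / 2 * (s ⬝ᵥ s - ∑ j, (D.psi x u j + s j * D.h j) ^ 2
        + ∑ j, D.psi x u j ^ 2 / (1 - D.h j ^ 2)) := by
    rw [dotProduct, ← Finset.sum_sub_distrib, ← Finset.sum_add_distrib, Finset.mul_sum]
    refine Finset.sum_congr rfl fun j _ => ?_
    have := h0 j
    rw [centre]
    field_simp
    ring
  rw [hj]
  simp only [sumElim_dotProduct_sumElim, hsq, normSq]
  ring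

/-! ### Integration over the fibre -/

variable (D) in
/-- The exponential factors of the Radon–Nikodym derivative on the fibre over `(x, u)`. -/
def expFactor (x u : RN n) (s : Fin k → ℝ) : PosReal :=
  ∏ j, toPos (Real.exp (-((D.h j ^ 2 - 1) / 2) * (s j - D.centre x u j) ^ 2))

theorem measurable_expFactor (x u : RN n) : Measurable (D.expFactor x u) := by
  have := measurable_toPos
  unfold expFactor
  fun_prop

theorem Phi_centre (hh : ∀ j, D.h j ^ 2 ≠ 1) (x u : RN n) (j : Fin k) :
    Phi (D.h j ^ 2 - 1) (D.h j ^ 2 * D.psi x u j ^ 2 / (2 * (1 - D.h j ^ 2) ^ 2))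
      = ENNReal.ofReal (Real.exp (D.centre x u j ^ 2 / 2)) • (gaussianReal 0 1).map
        (fun s => toPos (Real.exp (-((D.h j ^ 2 - 1) / 2) * (s - D.centre x u j) ^ 2))) := by
  rw [← Phi_eq_smul_map (sub_ne_zero.2 (hh j))]
  congr 1
  rw [centre, div_pow, mul_pow]
  field_simp

theorem multiConv_Phi (hh : ∀ j, D.h j ^ 2 ≠ 1) (x u : RN n) :
    multiConv (fun j =>
        Phi (D.h j ^ 2 - 1) (D.h j ^ 2 * D.psi x u j ^ 2 / (2 * (1 - D.h j ^ 2) ^ 2)))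
      = ENNReal.ofReal (Real.exp (1 / 2 * normSq (D.centre x u)))
        • (gaussN k).map (D.expFactor x u) := by
  have hE : ∀ j, Measurable fun s =>
      toPos (Real.exp (-((D.h j ^ 2 - 1) / 2) * (s - D.centre x u j) ^ 2)) := fun j =>
    measurable_toPos.comp (by fun_prop)
  have hEp : Measurable fun (s : Fin k → ℝ) (j : Fin k) =>
      toPos (Real.exp (-((D.h j ^ 2 - 1) / 2) * (s j - D.centre x u j) ^ 2)) :=
    measurable_pi_iff.2 fun j => (hE j).comp (measurable_pi_apply j)
  have hprod : Measurable fun t : Fin k → PosReal => ∏ j, t j := by fun_prop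
  have hfin : ∀ j, IsFiniteMeasure (ENNReal.ofReal (Real.exp (D.centre x u j ^ 2 / 2)) •
      (gaussianReal 0 1).map
        (fun s => toPos (Real.exp (-((D.h j ^ 2 - 1) / 2) * (s - D.centre x u j) ^ 2)))) :=
    fun j => Measure.smul_finite _ ENNReal.ofReal_ne_top
  have hpi : Measure.pi (fun j => ENNReal.ofReal (Real.exp (D.centre x u j ^ 2 / 2)) •
      (gaussianReal 0 1).map
        (fun s => toPos (Real.exp (-((D.h j ^ 2 - 1) / 2) * (s - D.centre x u j) ^ 2))))
      = (∏ j, ENNReal.ofReal (Real.exp (D.centre x u j ^ 2 / 2))) • Measure.pi (fun j =>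
      (gaussianReal 0 1).map
        (fun s => toPos (Real.exp (-((D.h j ^ 2 - 1) / 2) * (s - D.centre x u j) ^ 2)))) := by
    refine Measure.pi_eq fun s _ => ?_
    simp [Measure.pi_pi, Finset.prod_mul_distrib]
  rw [multiConv]
  simp_rw [Phi_centre hh]
  rw [hpi, ← Measure.pi_map_pi (fun j => (hE j).aemeasurable), Measure.map_smul,
    Measure.map_map hprod hEp,
    ← ENNReal.ofReal_prod_of_nonneg fun j _ => (Real.exp_pos _).le, ← Real.exp_sum]
  congr 3
  rw [normSq, dotProduct, Finset.mul_sum]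
  exact Finset.sum_congr rfl fun j _ => by ring

/-- Integration over the fibre measure is integration over the remaining Gaussian variables. -/
theorem lintegral_fibre (hc : IsUnit D.c.det) (hh : ∀ j, D.h j ^ 2 ≠ 1) (hG : D.finG.det ≠ 0)
    (x u : RN n) {f : PosReal → ℝ≥0∞} (hf : Measurable f) :
    ∫⁻ t, f t ∂(D.fibre x u)
      = ENNReal.ofReal (|D.T.det| * Real.exp (-(1 / 2) * normSq (D.y x u))) *
        ∫⁻ s, f (toPos (linDer D.finG (Sum.elim x (Sum.elim (D.y x u) s)))) ∂(gaussN k) := by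
  have hm := measurable_expFactor (D := D) x u
  have hp : 0 < D.point x u := by unfold point; positivity
  have hfin : IsFiniteMeasure (ENNReal.ofReal (Real.exp (1 / 2 * normSq (D.centre x u)))
        • (gaussN k).map (D.expFactor x u)) := Measure.smul_finite _ ENNReal.ofReal_ne_top
  have hmul : Measurable fun t => f (toPos (D.point x u) * t) := by fun_prop
  rw [fibre, multiConv_Phi hh, Measure.lintegral_mconv hf, N, lintegral_smul_measure,
    lintegral_dirac', lintegral_smul_measure, lintegral_map hmul hm, smul_eq_mul, smul_eq_mul,
    ← mul_assoc, ← ENNReal.ofReal_mul (by unfold weight; positivity)]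
  · congr 1
    · congr 1
      rw [weight, vecMul_transpose_mul_inv hh, mul_assoc, ← Real.exp_add]
      congr 2; ring
    · refine lintegral_congr fun s => ?_
      rw [linDer_finG hc hh, toPos_mul hp (Finset.prod_pos fun j _ => Real.exp_pos _),
        toPos_prod _ fun j => Real.exp_pos _]
      rfl
  · exact Measurable.lintegral_prod_right' (f := fun p : PosReal × PosReal => f (p.1 * p.2))
      (by fun_prop)

end FinData

/-! ### The law of the finite part -/

theorem map_sumElim_prod_pi {ι κ : Type*} [Fintype ι] [Fintype κ] :
    ((Measure.pi (fun _ : ι => gaussianReal 0 1)).prod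
      (Measure.pi (fun _ : κ => gaussianReal 0 1))).map (fun p => (Sum.elim p.1 p.2 : ι ⊕ κ → ℝ))
      = Measure.pi (fun _ : ι ⊕ κ => gaussianReal 0 1) := by
  simp only [← Measure.infinitePi_eq_pi]
  exact map_sumElim_prod_infinitePi _

theorem lintegral_pi_gaussianReal_sum {ι κ : Type*} [Fintype ι] [Fintype κ]
    {f : (ι ⊕ κ → ℝ) → ℝ≥0∞} (hf : Measurable f) :
    ∫⁻ z, f z ∂(Measure.pi (fun _ : ι ⊕ κ => gaussianReal 0 1))
      = ∫⁻ x, ∫⁻ y, f (Sum.elim x y) ∂(Measure.pi (fun _ : κ => gaussianReal 0 1))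
        ∂(Measure.pi (fun _ : ι => gaussianReal 0 1)) := by
  rw [← map_sumElim_prod_pi, lintegral_map hf measurable_sumElim]
  exact lintegral_prod _ (hf.comp measurable_sumElim).aemeasurable

theorem lintegral_gaussN {f : RN n → ℝ≥0∞} (hf : Measurable f) :
    ∫⁻ x, f x ∂(gaussN n) = ∫⁻ x, ENNReal.ofReal (gaussDensity x) * f x := by
  rw [gaussN, pi_gaussianReal_eq_withDensity,
    lintegral_withDensity_eq_lintegral_mul _ measurable_gaussDensity.ennreal_ofReal hf]
  rfl

/-- The joint law of the first block of `z`, the first block of `zM` and `dμ(zM)/dμ(z)` under the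
standard Gaussian measure. -/
def blockLaw (M : Matrix (FinIdx n k) (FinIdx n k) ℝ) : Measure (RN n × RN n × PosReal) :=
  (Measure.pi (fun _ : FinIdx n k => gaussianReal 0 1)).map fun z =>
    (fun i => z (Sum.inl i), fun i => (z ᵥ* M) (Sum.inl i), toPos (linDer M z))

theorem measurable_blockLaw_map (M : Matrix (FinIdx n k) (FinIdx n k) ℝ) :
    Measurable fun z : FinIdx n k → ℝ =>
      ((fun i => z (Sum.inl i), fun i => (z ᵥ* M) (Sum.inl i), toPos (linDer M z)) :
        RN n × RN n × PosReal) := by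
  have h1 := measurable_pi_iff.1 (measurable_vecMul M)
  have h2 := measurable_toPos.comp (measurable_linDer M)
  exact Measurable.prodMk (by fun_prop)
    (Measurable.prodMk (measurable_pi_iff.2 fun i => h1 (Sum.inl i)) h2)

theorem map_inl_pi_gaussianReal :
    (Measure.pi (fun _ : FinIdx n k => gaussianReal 0 1)).map (fun z i => z (Sum.inl i))
      = gaussN n := by
  rw [gaussN, ← Measure.infinitePi_eq_pi, ← Measure.infinitePi_eq_pi]
  exact Measure.map_infinitePi_infinitePi_of_inj Sum.inl_injective

/-- The second marginal condition holds because `dμ(zM)/dμ(z) · μ` is the image of `μ` under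
`z ↦ zM⁻¹`. -/
theorem isPolymorphism_blockLaw {M : Matrix (FinIdx n k) (FinIdx n k) ℝ} (hM : M.det ≠ 0) :
    IsPolymorphism (gaussN n) (gaussN n) (blockLaw M) where
  map_left := by
    rw [blockLaw, Measure.map_map (by fun_prop) (measurable_blockLaw_map M)]
    exact map_inl_pi_gaussianReal
  map_right := by
    have hB := measurable_blockLaw_map M
    have hv := measurable_vecMul M
    have hv' := measurable_vecMul M⁻¹
    have hp : Measurable fun z : FinIdx n k → ℝ => (fun i => z (Sum.inl i) : RN n) := by fun_prop
    have hd : Measurable fun z : RN n × RN n × PosReal => ENNReal.ofReal (z.2.2 : ℝ) := by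
      fun_prop
    have e : (fun z => ENNReal.ofReal (toPos (linDer M z) : ℝ))
        = fun z => ENNReal.ofReal (linDer M z) := by
      funext z; rw [coe_toPos (linDer_pos hM z)]
    rw [timesT, blockLaw, ← map_withDensity_comp hB hd, Measure.map_map (by fun_prop) hB]
    simp only [e]
    rw [← map_vecMul_inv_pi_gaussianReal hM]
    have hc : Measurable fun z : FinIdx n k → ℝ => (fun i => (z ᵥ* M) (Sum.inl i) : RN n) :=
      hp.comp hv
    refine (Measure.map_map hc hv').trans ?_
    rw [← map_inl_pi_gaussianReal (k := k)]
    congr 1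
    funext z
    simp [Matrix.vecMul_vecMul, Matrix.nonsing_inv_mul _ (isUnit_iff_ne_zero.2 hM)]

/-- Disintegration of the law over `(x, u)`, where `y` is replaced by `u = xa + yc`. -/
theorem FinData.lintegral_blockLaw {D : FinData n k} (hc : IsUnit D.c.det)
    (hh : ∀ j, D.h j ^ 2 ≠ 1) (hG : D.finG.det ≠ 0)
    {F : RN n × RN n × PosReal → ℝ≥0∞} (hF : Measurable F) :
    ∫⁻ z, F z ∂(blockLaw D.finG) = ∫⁻ x : RN n, ∫⁻ u : RN n,
      ENNReal.ofReal (((2 * Real.pi) ^ n)⁻¹ * Real.exp (-(x ⬝ᵥ x) / 2)) *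
        ∫⁻ t, F (x, u, t) ∂(D.fibre x u) := by
  set g : RN n → RN n → (Fin k → ℝ) → ℝ≥0∞ := fun x y s =>
    F (x, x ᵥ* D.a + y ᵥ* D.c, toPos (linDer D.finG (Sum.elim x (Sum.elim y s)))) with hg
  have ma := measurable_vecMul D.a
  have mc := measurable_vecMul D.c
  have ml := measurable_toPos.comp (measurable_linDer D.finG)
  have mg : Measurable fun p : RN n × RN n × (Fin k → ℝ) => g p.1 p.2.1 p.2.2 := by
    have m1 : Measurable fun p : RN n × RN n × (Fin k → ℝ) =>
        (Sum.elim p.1 (Sum.elim p.2.1 p.2.2) : FinIdx n k → ℝ) :=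
      measurable_sumElim.comp (measurable_fst.prodMk (measurable_sumElim.comp measurable_snd))
    exact hF.comp (measurable_fst.prodMk (Measurable.prodMk (by fun_prop) (ml.comp m1)))
  have mg2 : Measurable fun p : RN n × RN n => ∫⁻ s, g p.1 p.2 s ∂(gaussN k) :=
    Measurable.lintegral_prod_right' (f := fun q : (RN n × RN n) × (Fin k → ℝ) =>
      g q.1.1 q.1.2 q.2) (mg.comp
      (measurable_fst.fst.prodMk (measurable_fst.snd.prodMk measurable_snd)))
  have mg3 : Measurable fun x : RN n => ∫⁻ y, ∫⁻ s, g x y s ∂(gaussN k) ∂(gaussN n) :=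
    Measurable.lintegral_prod_right' (f := fun q : RN n × RN n =>
      ∫⁻ s, g q.1 q.2 s ∂(gaussN k)) mg2
  have mFB := hF.comp (measurable_blockLaw_map D.finG)
  have hsplit : ∫⁻ z, F z ∂(blockLaw D.finG)
      = ∫⁻ x, ∫⁻ y, ∫⁻ s, g x y s ∂(gaussN k) ∂(gaussN n) ∂(gaussN n) := by
    rw [blockLaw, lintegral_map hF (measurable_blockLaw_map _)]
    refine (lintegral_pi_gaussianReal_sum mFB).trans ?_
    refine lintegral_congr fun x => ?_
    refine (lintegral_pi_gaussianReal_sum (mFB.comp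
      (measurable_sumElim.comp (measurable_const.prodMk measurable_id)))).trans ?_
    refine lintegral_congr fun y => lintegral_congr fun s => ?_
    change F (x, fun i => (Sum.elim x (Sum.elim y s) ᵥ* D.finG) (Sum.inl i), _) = _
    rw [FinData.vecMul_finG]
    rfl
  have hcinv : D.c⁻¹.det ≠ 0 := by
    rw [Matrix.det_nonsing_inv]
    simpa using hc.ne_zero
  rw [hsplit, lintegral_gaussN mg3]
  refine lintegral_congr fun x => ?_
  have mgx : Measurable fun y => ∫⁻ s, g x y s ∂(gaussN k) :=
    mg2.comp (measurable_const.prodMk measurable_id)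
  have mgd : Measurable fun y => ENNReal.ofReal (gaussDensity y) * ∫⁻ s, g x y s ∂(gaussN k) :=
    measurable_gaussDensity.ennreal_ofReal.mul mgx
  -- the substitution `u = xa + yc`
  rw [lintegral_gaussN mgx,
    lintegral_comp_vecMul hcinv mgd,
    ← lintegral_sub_right_eq_self _ (x ᵥ* D.a), ← lintegral_const_mul' _ _ ENNReal.ofReal_ne_top,
    ← lintegral_const_mul' _ _ ENNReal.ofReal_ne_top]
  refine lintegral_congr fun u => ?_
  have mFt : Measurable fun t => F (x, u, t) :=
    hF.comp (measurable_const.prodMk (measurable_const.prodMk measurable_id))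
  rw [FinData.lintegral_fibre hc hh hG x u mFt]
  simp only [← FinData.y_eq, hg, FinData.vecMul_a_add_y_vecMul_c hc]
  rw [← mul_assoc, ← mul_assoc, ← mul_assoc, ← ENNReal.ofReal_mul (gaussDensity_pos x).le,
    ← ENNReal.ofReal_mul (mul_nonneg (gaussDensity_pos x).le (abs_nonneg _)),
    ← ENNReal.ofReal_mul (by positivity)]
  congr 2
  have hpi : Real.sqrt (2 * Real.pi) ^ n * Real.sqrt (2 * Real.pi) ^ n = (2 * Real.pi) ^ n := by
    rw [← mul_pow, Real.mul_self_sqrt (by positivity)]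
  rw [gaussDensity, gaussDensity, Fintype.card_fin, ← hpi, FinData.T, FinData.normSq,
    show -(1 / 2) * (D.y x u ⬝ᵥ D.y x u) = -(D.y x u ⬝ᵥ D.y x u) / 2 by ring]
  field_simp

end Polym
end

theorem mainTheorem4 (n k : ℕ) (D : Polym.FinData n k)
    (hc : IsUnit D.c.det) (hh : ∀ j, D.h j ^ 2 ≠ 1)
    (𝔞 : Polym.Coll n) (G : Polym.GLO n) (hG : Polym.Coll.mk G = 𝔞)
    (hD : D.IsRep ((G : (Polym.Hil n →L[ℝ] Polym.Hil n)ˣ) : Polym.Hil n →L[ℝ] Polym.Hil n))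
    (A : Polym.GLO n) (hA : Polym.Coll.mk A = 𝔞) :
    Polym.IsPolymorphism (Polym.gaussN n) (Polym.gaussN n) (Polym.tau A) ∧
    ∀ F : Polym.RN n × Polym.RN n × Polym.PosReal → ℝ≥0∞, Measurable F →
      ∫⁻ z, F z ∂(Polym.tau A) =
        ∫⁻ x : Polym.RN n, ∫⁻ u : Polym.RN n,
          ENNReal.ofReal (((2 * Real.pi) ^ n)⁻¹ * Real.exp (-(x ⬝ᵥ x) / 2)) *
            ∫⁻ t, F (x, u, t) ∂(D.fibre x u) ∂volume ∂volume := by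
  have hB := hD.isFiniteBlock
  obtain ⟨U, hU, V, hV, hAG⟩ := (DoubleCoset.rel_iff (H := Polym.OInf n) (K := Polym.OInf n)).1
    (Quotient.exact (s := Polym.collSetoid n) (hG.trans hA.symm))
  have htau : Polym.tau A = Polym.blockLaw D.finG := by
    rw [Polym.tau_eq_of_doubleCoset A hAG hU hV hB, Polym.blockLaw]
    have h1 := Measure.map_map (μ := Polym.gaussNInf n) (Polym.measurable_blockLaw_map D.finG)
      (measurable_fst.comp (Polym.measurable_blockCoords (n := n) (k := k)))
    rw [← Measure.map_map measurable_fst Polym.measurable_blockCoords,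
      Polym.map_blockCoords_gaussNInf, ← Measure.fst, Measure.fst_prod] at h1
    exact h1.symm
  rw [htau]
  exact ⟨Polym.isPolymorphism_blockLaw hB.det_ne_zero,
    fun F hF => Polym.FinData.lintegral_blockLaw hc hh hB.det_ne_zero hF⟩
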